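/- **Curves.** All curves in the plane are continuous, piecewise $C^1$ (with a locally finite set of break points) and parametrized by arc length. An *infinite curve* is given by $\gamma:\mathbb R\to\mathbb R^2$; a *loop* of length $L>0$ by $\gamma:[0,L]\to\mathbb R^2$ with $\gamma(0)=\gamma(L)$. For such a curve $\Lambda$ let $\operatorname{dist}_\Lambda$ be the distance along the curve ($|s-s'|$ for an infinite curve, $\min\{|s-s'|,L-|s-s'|\}$ for a loop), and let $$c(\Lambda)=\inf \frac{|\gamma(s)-\gamma(s')|}{\operatorname{dist}_\Lambda(s,s')},$$ the infimum being over all $s,s'$ with $\operatorname{dist}_\Lambda(s,s')>0$. A curve parametrized by an unbounded interval $I$ is *asymptotically straight* if there are $d>0$, $\mu>\tfrac12$, $\omega\in(0,1)$ such that $$1-\frac{|\gamma(s)-\gamma(s')|}{|s-s'|}\le d\,\bigl[1+|s+s'|^{2\mu}\bigr]^{-1/2}\qquad\text{for all } s\ne s'\text{ in } I \text{ with } \omega\le \tfrac{s}{s'}\le\omega^{-1}.$$ **Metric graph.** Let $\Gamma=\bigcup_{i=1}^N\Gamma_i\subset\mathbb R^2$ be a finite metric graph: each edge (segment) $\Gamma_i$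 is a curve parametrized by $[0,L_i]$ with $L_i>0$, by $[0,\infty)$ or by $\mathbb R$, without self-intersections except that the two ends of a bounded edge may coincide, and different edges intersect only at ends. Assume that every unbounded edge is asymptotically straight. **Form and operator.** Let $m_\Gamma$ be the one-dimensional Hausdorff measure restricted to $\Gamma$, $L^2(\Gamma)=L^2(\mathbb R^2,m_\Gamma)$, and let $I_\Gamma:H^1(\mathbb R^2)\to L^2(\Gamma)$ be the bounded linear extension of the restriction map $\psi\mapsto\psi$ on Schwartz functions. For a constant $\alpha>0$ put $$q_{\alpha,\Gamma}[u]=\|\nabla u\|^2_{L^2(\mathbb R^2)}-\alpha\|I_\Gamma u\|^2_{L^2(\Gamma)},\qquad \operatorname{dom} q_{\alpha,\Gamma}=H^1(\mathbb R^2).$$ **Theorem.** Assume that for each $i$ there is an extension $\Gamma_i^{\rm ext}\supset\Gamma_i$ which is either a loop or an asymptotically straight infinite curve (continuous and piecewise $C^1$, as above), with $c(\Gamma_i^{\rm ext})>0$. Then $I_\Gamma$ exists and is unique, the form $q_{\alpha,\Gamma}$ is closed and bounded from below, there is a unique self-adjoint operator $H_{\alpha,\Gamma}$ in $L^2(\mathbb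 R^2)$ corresponding to it (that is, $\operatorname{dom}H_{\alpha,\Gamma}\subset H^1(\mathbb R^2)$ and $q_{\alpha,\Gamma}(v,u)=\langle v,H_{\alpha,\Gamma}u\rangle$ for all $u\in\operatorname{dom}H_{\alpha,\Gamma}$, $v\in H^1(\mathbb R^2)$, where $q_{\alpha,\Gamma}(\cdot,\cdot)$ is the associated sesquilinear form), and $$\inf\sigma(H_{\alpha,\Gamma})\ \ge\ -N\sum_{i=1}^N\frac{\alpha^2}{4\,c(\Gamma_i^{\rm ext})^2}.$$ -/

import Mathlib

open MeasureTheory Filter Topology Set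
open scoped SchwartzMap LineDeriv InnerProductSpace ComplexConjugate

noncomputable section

namespace Leaky

/-! ### Curves and metric graphs in the plane -/

/-- The Euclidean plane. -/
abbrev Plane : Type := EuclideanSpace ℝ (Fin 2)

/-- `γ`, restricted to the interval `I`, is continuous, piecewise `C¹` and naturally parametrized.
The set `S` of break points is locally finite; between consecutive break points `γ` is `C¹` up to
the end points. -/
def IsPiecewiseC1 (γ : ℝ → Plane) (I : Set ℝ) : Prop :=
  ContinuousOn γ I ∧
  ∃ S : Set ℝ, (∀ a b : ℝ, (S ∩ Icc a b).Finite) ∧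
    (∀ a b : ℝ, a < b → Icc a b ⊆ I → Disjoint (Ioo a b) S → ContDiffOn ℝ 1 γ (Icc a b)) ∧
    ∀ s ∈ interior I \ S, ‖deriv γ s‖ = 1

/-- Asymptotic straightness of a naturally parametrized curve `γ : I → ℝ²`: for some `d > 0`,
`μ > 1/2`, `ω ∈ (0,1)`,
`1 - |γ(s) - γ(s')| / |s - s'| ≤ d (1 + |s + s'|^(2μ))^(-1/2)`
for all distinct `s, s'` in `I` in the sector `ω ≤ s / s' ≤ ω⁻¹`. -/
def IsAsymptoticallyStraight (γ : ℝ → Plane) (I : Set ℝ) : Prop :=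
  ∃ d μ ω : ℝ, 0 < d ∧ 1 / 2 < μ ∧ 0 < ω ∧ ω < 1 ∧
    ∀ s ∈ I, ∀ s' ∈ I, s ≠ s' → s' ≠ 0 → ω ≤ s / s' → s / s' ≤ ω⁻¹ →
      1 - ‖γ s - γ s'‖ / |s - s'| ≤ d * (1 + |s + s'| ^ (2 * μ)) ^ (-(1 / 2) : ℝ)

/-- A curve given by a parametrization: an infinite curve `ℝ → ℝ²`, or a loop `[0, L] → ℝ²`. -/
inductive Curve : Type
  | line (γ : ℝ → Plane) : Curve
  | loop (L : ℝ) (γ : ℝ → Plane) : Curve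

namespace Curve

/-- The parametrization. -/
def param : Curve → ℝ → Plane
  | line γ => γ
  | loop _ γ => γ

/-- The parameter interval. -/
def dom : Curve → Set ℝ
  | line _ => univ
  | loop L _ => Icc 0 L

/-- The distance along the curve between the points with parameters `s` and `t`. -/
def arcDist : Curve → ℝ → ℝ → ℝ
  | line _, s, t => |s - t|
  | loop L _, s, t => min |s - t| (L - |s - t|)

/-- The curve as a subset of the plane. -/
def carrier (Λ : Curve) : Set Plane := Λ.param '' Λ.dom

/-- `c(Λ)`: the infimum of (distance in the plane) / (distance along the curve) over all pairs of
points at positive distance along the curve. -/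
def c (Λ : Curve) : ℝ :=
  sInf {r : ℝ | ∃ s ∈ Λ.dom, ∃ t ∈ Λ.dom, 0 < Λ.arcDist s t ∧
    r = ‖Λ.param s - Λ.param t‖ / Λ.arcDist s t}

/-- The curve is continuous, piecewise `C¹`, naturally parametrized, and it is either an infinite
asymptotically straight curve or a loop. -/
def IsAdmissible : Curve → Prop
  | line γ => IsPiecewiseC1 γ univ ∧ IsAsymptoticallyStraight γ univ
  | loop L γ => 0 < L ∧ IsPiecewiseC1 γ (Icc 0 L) ∧ γ 0 = γ L

end Curve

/-- A finite metric graph in the plane with `N` segments (edges). Each segment is a continuous,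
piecewise `C¹`, naturally parametrized curve, bounded or unbounded, without self-intersections
except that the end points of a bounded segment may coincide; different segments meet only at
their end points. -/
structure MetricGraph (N : ℕ) where
  /-- the parameter intervals -/
  dom : Fin N → Set ℝ
  /-- the parametrizations -/
  param : Fin N → ℝ → Plane
  dom_eq : ∀ i, (∃ L : ℝ, 0 < L ∧ dom i = Icc 0 L) ∨ dom i = Ici 0 ∨ dom i = univ
  piecewiseC1 : ∀ i, IsPiecewiseC1 (param i) (dom i)
  simple : ∀ i, ∀ s ∈ dom i, ∀ t ∈ dom i, param i s = param i t →
    s = t ∨ (s ∈ frontier (dom i) ∧ t ∈ frontier (dom i))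
  inter : ∀ i j, i ≠ j → ∀ s ∈ dom i, ∀ t ∈ dom j, param i s = param j t →
    s ∈ frontier (dom i) ∧ t ∈ frontier (dom j)

namespace MetricGraph

variable {N : ℕ}

/-- The `i`-th segment as a subset of the plane. -/
def edge (G : MetricGraph N) (i : Fin N) : Set Plane := G.param i '' G.dom i

/-- The graph as a subset of the plane. -/
def carrier (G : MetricGraph N) : Set Plane := ⋃ i, G.edge i

end MetricGraph

/-- The measure `m_Γ(M) = l₁(M ∩ Γ)`, with `l₁` the one-dimensional Hausdorff measure. -/
def lengthMeasure (Γ : Set Plane) : Measure Plane := (μH[1] : Measure Plane).restrict Γ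

/-! ### The Sobolev space `H¹(ℝ²)` -/

/-- The complex Hilbert space `L²(ℝ²)`. -/
abbrev L2 : Type := Lp ℂ 2 (volume : Measure Plane)

/-- The standard basis vectors of the plane. -/
def e (i : Fin 2) : Plane := EuclideanSpace.single i 1

/-- `g` is the weak `i`-th partial derivative of `u`. -/
def HasWeakPartial (i : Fin 2) (u g : L2) : Prop :=
  ∂_{e i} (u : 𝓢'(Plane, ℂ)) = (g : 𝓢'(Plane, ℂ))

theorem hasWeakPartial_iff (i : Fin 2) (u g : L2) :
    HasWeakPartial i u g ↔
      ∀ φ : 𝓢(Plane, ℂ), ∫ x, (∂_{e i} φ) x * u x = - ∫ x, φ x * g x := by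
  have key : HasWeakPartial i u g ↔ ∀ φ : 𝓢(Plane, ℂ),
      (∂_{e i} (u : 𝓢'(Plane, ℂ))) φ = (g : 𝓢'(Plane, ℂ)) φ := by
    unfold HasWeakPartial
    exact ⟨fun h φ => by rw [h], fun h => by ext φ; exact h φ⟩
  rw [key]
  refine forall_congr' fun φ => ?_
  rw [TemperedDistribution.lineDerivOp_apply_apply, map_neg, Lp.toTemperedDistribution_apply,
    Lp.toTemperedDistribution_apply]
  simp only [smul_eq_mul]
  exact neg_eq_iff_eq_neg

theorem HasWeakPartial.unique {i : Fin 2} {u g g' : L2} (h : HasWeakPartial i u g)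
    (h' : HasWeakPartial i u g') : g = g' := by
  have hk := Lp.ker_toTemperedDistributionCLM_eq_bot (F := ℂ) (μ := (volume : Measure Plane))
    (p := 2)
  apply LinearMap.ker_eq_bot.mp hk
  have : (g : 𝓢'(Plane, ℂ)) = (g' : 𝓢'(Plane, ℂ)) := Eq.trans (Eq.symm h) h'
  simpa using this

theorem HasWeakPartial.add {i : Fin 2} {u v g h : L2} (hu : HasWeakPartial i u g)
    (hv : HasWeakPartial i v h) : HasWeakPartial i (u + v) (g + h) := by
  unfold HasWeakPartial at *
  rw [← Lp.toTemperedDistributionCLM_apply] at *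
  rw [map_add, LineDeriv.lineDerivOp_add]
  simp only [Lp.toTemperedDistributionCLM_apply] at *
  rw [hu, hv]
  simp only [← Lp.toTemperedDistributionCLM_apply, map_add]

theorem HasWeakPartial.smul {i : Fin 2} {u g : L2} (a : ℂ) (hu : HasWeakPartial i u g) :
    HasWeakPartial i (a • u) (a • g) := by
  unfold HasWeakPartial at *
  rw [← Lp.toTemperedDistributionCLM_apply] at *
  rw [map_smul, LineDeriv.lineDerivOp_smul]
  simp only [Lp.toTemperedDistributionCLM_apply] at *
  rw [hu]
  simp only [← Lp.toTemperedDistributionCLM_apply, map_smul]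

/-- `H¹(ℝ²)`: the functions in `L²(ℝ²)` whose weak partial derivatives are in `L²(ℝ²)`. -/
def H1 : Submodule ℂ L2 where
  carrier := {u | ∀ i, ∃ g : L2, HasWeakPartial i u g}
  add_mem' := fun hu hv i => by
    obtain ⟨g, hg⟩ := hu i
    obtain ⟨h, hh⟩ := hv i
    exact ⟨g + h, hg.add hh⟩
  zero_mem' := fun i => ⟨0, by
    rw [hasWeakPartial_iff]
    intro φ
    have h0 : ((0 : L2) : Plane → ℂ) =ᵐ[volume] 0 := Lp.coeFn_zero _ _ _
    rw [integral_congr_ae (g := fun _ => (0 : ℂ)) (by filter_upwards [h0] with x hx; simp),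
      integral_congr_ae (f := fun x => φ x * _) (g := fun _ => (0 : ℂ))
        (by filter_upwards [h0] with x hx; simp)]
    simp⟩
  smul_mem' := fun a u hu i => by
    obtain ⟨g, hg⟩ := hu i
    exact ⟨a • g, hg.smul a⟩

theorem exists_weakPartial (i : Fin 2) (u : H1) : ∃ g : L2, HasWeakPartial i u g := u.2 i

/-- The weak partial derivative `∂ᵢ : H¹(ℝ²) → L²(ℝ²)`. -/
def partialDeriv (i : Fin 2) : H1 →ₗ[ℂ] L2 where
  toFun u := (exists_weakPartial i u).choose
  map_add' u v := (exists_weakPartial i (u + v)).choose_spec.unique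
    ((exists_weakPartial i u).choose_spec.add (exists_weakPartial i v).choose_spec)
  map_smul' a u := (exists_weakPartial i (a • u)).choose_spec.unique
    ((exists_weakPartial i u).choose_spec.smul a)

theorem partialDeriv_spec (i : Fin 2) (u : H1) : HasWeakPartial i u (partialDeriv i u) :=
  (exists_weakPartial i u).choose_spec

/-- `‖∇u‖²` in `L²(ℝ²)`. -/
def gradNormSq (u : H1) : ℝ := ∑ i, ‖partialDeriv i u‖ ^ 2

theorem schwartz_mem_H1 (ψ : 𝓢(Plane, ℂ)) : ψ.toLp 2 (volume : Measure Plane) ∈ H1 := by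
  intro i
  refine ⟨(∂_{e i} ψ).toLp 2 volume, ?_⟩
  unfold HasWeakPartial
  rw [Lp.toTemperedDistribution_toLp_eq, Lp.toTemperedDistribution_toLp_eq]
  exact TemperedDistribution.lineDerivOp_toTemperedDistributionCLM_eq ψ (e i)

/-- A Schwartz function as an element of `H¹(ℝ²)`. -/
def schwartzToH1 (ψ : 𝓢(Plane, ℂ)) : H1 := ⟨ψ.toLp 2 volume, schwartz_mem_H1 ψ⟩

/-- `L²(Γ) = L²(ℝ², m_Γ)`. -/
abbrev L2On (Γ : Set Plane) : Type := Lp ℂ 2 (lengthMeasure Γ)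

/-- `T` is the operator `I_Γ : H¹(ℝ²) → L²(Γ)`: the extension, bounded with respect to the norm of
`H¹(ℝ²)`, of the restriction map `ψ ↦ ψ` on Schwartz functions. -/
def IsTraceOperator (Γ : Set Plane) (T : H1 →ₗ[ℂ] L2On Γ) : Prop :=
  (∃ C : ℝ, ∀ u : H1, ‖T u‖ ^ 2 ≤ C * (gradNormSq u + ‖(u : L2)‖ ^ 2)) ∧
  ∀ ψ : 𝓢(Plane, ℂ), T (schwartzToH1 ψ) =ᵐ[lengthMeasure Γ] ψ

/-! ### Forms and operators in a Hilbert space -/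

section Abstract

variable {E : Type*} [NormedAddCommGroup E] [InnerProductSpace ℂ E]

variable (E) in
/-- A symmetric sesquilinear form (antilinear in the first argument) defined on a subspace. -/
structure SymForm where
  /-- the domain -/
  dom : Submodule ℂ E
  /-- the sesquilinear form -/
  form : dom →ₗ⋆[ℂ] dom →ₗ[ℂ] ℂ
  symm : ∀ u v, conj (form u v) = form v u

namespace SymForm

/-- The quadratic form `q[u] = q(u, u)`, which is real by symmetry. -/
def quad (q : SymForm E) (u : q.dom) : ℝ := (q.form u u).re

/-- `q` is bounded from below. -/
def IsBoundedBelow (q : SymForm E) : Prop :=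
  ∃ m : ℝ, ∀ u : q.dom, m * ‖(u : E)‖ ^ 2 ≤ q.quad u

/-- `q` is closed: if `uₙ ∈ dom q`, `uₙ → u` in the Hilbert space and `q[uₙ - uₘ] → 0`, then
`u ∈ dom q` and `q[uₙ - u] → 0`. -/
def IsClosed (q : SymForm E) : Prop :=
  ∀ (u : ℕ → q.dom) (w : E), Tendsto (fun n => (u n : E)) atTop (𝓝 w) →
    Tendsto (fun p : ℕ × ℕ => q.quad (u p.1 - u p.2)) atTop (𝓝 0) →
    ∃ h : w ∈ q.dom, Tendsto (fun n => q.quad (u n - ⟨w, h⟩)) atTop (𝓝 0)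

/-- The operator `A` corresponds to the form `q`: `dom A ⊆ dom q` and `q(v, u) = ⟨v, A u⟩` for all
`u ∈ dom A` and `v ∈ dom q`. -/
def Corresponds (q : SymForm E) (A : E →ₗ.[ℂ] E) : Prop :=
  ∀ u : A.domain, ∃ h : (u : E) ∈ q.dom, ∀ v : q.dom,
    q.form v ⟨u, h⟩ = ⟪(v : E), A u⟫_ℂ

end SymForm

/-- `z` is in the resolvent set of `A`: `A - z` is a bijection of `dom A` onto the whole space with
bounded inverse. -/
def IsResolventPoint (A : E →ₗ.[ℂ] E) (z : ℂ) : Prop :=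
  ∃ R : E →L[ℂ] E,
    (∀ f : E, ∃ h : R f ∈ A.domain, A ⟨R f, h⟩ - z • R f = f) ∧
    ∀ u : A.domain, R (A u - z • (u : E)) = u

/-- The spectrum of a (possibly unbounded) operator. -/
def opSpectrum (A : E →ₗ.[ℂ] E) : Set ℂ := {z | ¬ IsResolventPoint A z}

/-- `inf σ(A)` for a self-adjoint operator `A`, whose spectrum is real. The infimum is taken in the
extended real line. -/
def infSpectrum (A : E →ₗ.[ℂ] E) : EReal :=
  sInf ((fun z : ℂ => (z.re : EReal)) '' opSpectrum A)

end Abstract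

/-! ### The form of the leaky quantum graph -/

/-- The form `q_{α,Γ}` on `H¹(ℝ²)`, for `T = I_Γ`:
`q(v, u) = ∑ᵢ ⟨∂ᵢ v, ∂ᵢ u⟩ - α ⟨T v, T u⟩`. -/
def deltaForm (α : ℝ) {Γ : Set Plane} (T : H1 →ₗ[ℂ] L2On Γ) : SymForm L2 where
  dom := H1
  form := LinearMap.mk₂'ₛₗ (starRingEnd ℂ) (RingHom.id ℂ)
    (fun v u => ∑ i, ⟪partialDeriv i v, partialDeriv i u⟫_ℂ - (α : ℂ) * ⟪T v, T u⟫_ℂ)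
    (fun v v' u => by
      simp only [map_add, inner_add_left, Finset.sum_add_distrib]; ring)
    (fun a v u => by
      simp only [map_smul, inner_smul_left, smul_eq_mul, ← Finset.mul_sum]; ring)
    (fun v u u' => by
      simp only [map_add, inner_add_right, Finset.sum_add_distrib]; ring)
    (fun a v u => by
      simp only [map_smul, inner_smul_right, smul_eq_mul, ← Finset.mul_sum, RingHom.id_apply]
      ring)
  symm u v := by
    simp only [LinearMap.mk₂'ₛₗ_apply, map_sub, map_sum, map_mul, inner_conj_symm,
      Complex.conj_ofReal]

theorem deltaForm_apply (α : ℝ) {Γ : Set Plane} (T : H1 →ₗ[ℂ] L2On Γ) (v u : H1) :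
    (deltaForm α T).form v u =
      ∑ i, ⟪partialDeriv i v, partialDeriv i u⟫_ℂ - (α : ℂ) * ⟪T v, T u⟫_ℂ := rfl

/-- `q_{α,Γ}[u] = ‖∇u‖² - α ‖I_Γ u‖²`. -/
theorem deltaForm_quad (α : ℝ) {Γ : Set Plane} (T : H1 →ₗ[ℂ] L2On Γ) (u : H1) :
    (deltaForm α T).quad u = gradNormSq u - α * ‖T u‖ ^ 2 := by
  have h : (deltaForm α T).form u u =
      ((gradNormSq u - α * ‖T u‖ ^ 2 : ℝ) : ℂ) := by
    rw [deltaForm_apply]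
    simp only [inner_self_eq_norm_sq_to_K, gradNormSq]
    push_cast
    rfl
  exact (congrArg Complex.re h).trans (Complex.ofReal_re _)

end Leaky

end

noncomputable section

namespace Leaky

open scoped FourierTransform

/-! ### Closed forms and self-adjoint operators -/

section FormTheory

variable {E V : Type*} [NormedAddCommGroup E] [InnerProductSpace ℂ E] [CompleteSpace E]
  [NormedAddCommGroup V] [InnerProductSpace ℂ V] [CompleteSpace V]

namespace SymForm

/-! Everything rests on one trace inequality. Let `ν` be the arc length measure of a curve `Λ` and
`c = c(Λ)`. The chord–arc bound `|γ(s) - γ(s')| ≥ c · dist(s, s')` dominates the Gaussian `exp(-|x -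
y|² / 4t)` on the curve by one in arc distance, whose integral is at most its value `√(4πt) / c` on
a straight line (`Curve.gaussianSchur_arcMeasure`). By the Schur test the heat kernel, as an
operator on `L²(ν)`, then has norm at most `1 / (c √(4πt))`. Integrating against `exp(-κ² t)` turns
the heat kernel into the resolvent kernel of `-Δ + κ²`, with norm at most `1 / (2κc)`
(`GaussianSchur.lintegral_measureFourier_div_le`). Duality converts this into `‖ψ‖²_{L²(ν)} ≤ (‖∇ψ‖²
+ κ² ‖ψ‖²) / (2κc)` (`GaussianSchur.lintegral_enorm_sq_le`).

For `N` edges, `κᵢ = Nα / (2cᵢ)` lets each edge use exactly the share `1/N` of `‖∇ψ‖²`; the sum over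
the edges leaves the constant `N ∑ α² / (4cᵢ²)` in front of `‖ψ‖²` (`hasTraceBound_carrier`).

Since Schwartz functions are dense in `H¹`, the inequality yields existence and uniqueness of the
trace and the lower bound of the form. Used with `2α` in place of `α`, it makes the form coercive on
`H¹` up to a multiple of the `L²` norm. Lax–Milgram then inverts the form below its lower bound, and
this gives closedness, the unique self-adjoint operator and the bound on its spectrum
(`SymForm.Realization`). -/

/-- A form `q` together with a Hilbert space structure on its domain for which the form is bounded,
the inclusion is bounded, and `q` is coercive up to a multiple of the ambient norm. -/
structure Realization (q : SymForm E) (V : Type*) [NormedAddCommGroup V] [InnerProductSpace ℂ V]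
    [CompleteSpace V] where
  /-- the parametrization of the domain -/
  toDom : V →ₗ[ℂ] q.dom
  surj : Function.Surjective toDom
  /-- the inclusion into the ambient space -/
  incl : V →L[ℂ] E
  incl_apply : ∀ v, incl v = (toDom v : E)
  /-- the bounded operator representing the form -/
  op : V →L[ℂ] V
  inner_op : ∀ v w, ⟪v, op w⟫_ℂ = q.form (toDom v) (toDom w)
  /-- the coercivity constant -/
  δ : ℝ
  δ_pos : 0 < δ
  /-- the shift -/
  b : ℝ
  coercive : ∀ v, δ * ‖v‖ ^ 2 ≤ q.quad (toDom v) + b * ‖(toDom v : E)‖ ^ 2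

variable {q : SymForm E} {m : ℝ}

omit [CompleteSpace E] in
-- Take `θ` times the coercivity estimate plus `1 - θ` times the lower bound `m`. For small `θ` the
-- coefficient of the ambient norm, `m - θ (b + m)`, is still at least `x`, while `θ δ ‖v‖²`
-- survives.
theorem Realization.coercive_of_lt (r : q.Realization V)
    (hm : ∀ u : q.dom, m * ‖(u : E)‖ ^ 2 ≤ q.quad u) {x : ℝ} (hx : x < m) :
    ∃ ε > 0, ∀ v, ε * ‖v‖ ^ 2 ≤ q.quad (r.toDom v) - x * ‖(r.toDom v : E)‖ ^ 2 := by
  have hpos : 0 < m - x + |r.b + m| := by have := abs_nonneg (r.b + m); linarith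
  set θ := (m - x) / (m - x + |r.b + m|) with hθ
  have hθ0 : 0 < θ := div_pos (by linarith) hpos
  have hθ1 : θ ≤ 1 := by
    rw [hθ, div_le_one hpos]; have := abs_nonneg (r.b + m); linarith
  have hθ2 : θ * (r.b + m) ≤ m - x := by
    have h1 : θ * (m - x + |r.b + m|) = m - x := div_mul_cancel₀ _ hpos.ne'
    have h2 : θ * (r.b + m) ≤ θ * |r.b + m| := mul_le_mul_of_nonneg_left (le_abs_self _) hθ0.le
    have h3 : 0 ≤ θ * (m - x) := mul_nonneg hθ0.le (by linarith)
    linarith [mul_add θ (m - x) |r.b + m|]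
  refine ⟨θ * r.δ, mul_pos hθ0 r.δ_pos, fun v => ?_⟩
  have h1 := mul_le_mul_of_nonneg_left (r.coercive v) hθ0.le
  have h2 := mul_le_mul_of_nonneg_left (hm (r.toDom v)) (sub_nonneg.mpr hθ1)
  have h3 := mul_le_mul_of_nonneg_right hθ2 (sq_nonneg ‖(r.toDom v : E)‖)
  nlinarith

omit [CompleteSpace E] in
theorem eq_of_forall_form_sub_eq (hm : ∀ u : q.dom, m * ‖(u : E)‖ ^ 2 ≤ q.quad u) {z : ℂ}
    (hz : z.re < m) {u u' : q.dom}
    (h : ∀ v : q.dom, q.form v u - z * ⟪(v : E), (u : E)⟫_ℂ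
      = q.form v u' - z * ⟪(v : E), (u' : E)⟫_ℂ) : u = u' := by
  have h1 : q.form (u - u') (u - u') - z * ⟪((u - u' : q.dom) : E), ((u - u' : q.dom) : E)⟫_ℂ = 0 := by
    have := h (u - u')
    rw [map_sub (q.form (u - u')), Submodule.coe_sub, inner_sub_right]
    linear_combination this
  have h2 : q.quad (u - u') - z.re * ‖((u - u' : q.dom) : E)‖ ^ 2 = 0 := by
    have := congrArg Complex.re h1
    rw [inner_self_eq_norm_sq_to_K] at this
    simpa [quad, ← Complex.ofReal_pow] using this
  have h3 := hm (u - u')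
  have h4 : ‖((u - u' : q.dom) : E)‖ ^ 2 ≤ 0 := by nlinarith
  have h5 : ((u - u' : q.dom) : E) = 0 := by
    rw [← norm_eq_zero]; exact pow_eq_zero_iff two_ne_zero |>.mp (le_antisymm h4 (sq_nonneg _))
  exact sub_eq_zero.mp (Subtype.ext h5)

/-! ### Weak resolvents and the self-adjoint operator of a form -/

/-- `R` solves the weak equation `q(v, R f) - z ⟨v, R f⟩ = ⟨v, f⟩`. -/
def IsWeakResolvent (q : SymForm E) (z : ℂ) (R : E →L[ℂ] E) : Prop :=
  ∀ f, ∃ h : R f ∈ q.dom, ∀ v : q.dom,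
    q.form v ⟨R f, h⟩ - z * ⟪(v : E), R f⟫_ℂ = ⟪(v : E), f⟫_ℂ

/-- Lax–Milgram on `V`: with `ι` the inclusion, `B = op - z ι*ι` represents the shifted form and is
coercive because `z.re < m`. The resolvent is `ι B⁻¹ ι*`. -/
theorem Realization.exists_weakResolvent (r : q.Realization V)
    (hm : ∀ u : q.dom, m * ‖(u : E)‖ ^ 2 ≤ q.quad u) {z : ℂ} (hz : z.re < m) :
    ∃ R : E →L[ℂ] E, q.IsWeakResolvent z R := by
  obtain ⟨ε, hε, hco⟩ := r.coercive_of_lt hm hz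
  set B : V →L[ℂ] V := r.op - z • (r.incl.adjoint ∘L r.incl) with hB
  have hBi : ∀ v w, ⟪v, B w⟫_ℂ
      = q.form (r.toDom v) (r.toDom w) - z * ⟪(r.toDom v : E), (r.toDom w : E)⟫_ℂ := by
    intro v w
    rw [hB, _root_.sub_apply, inner_sub_right, r.inner_op,
      _root_.smul_apply, inner_smul_right, ContinuousLinearMap.comp_apply,
      ContinuousLinearMap.adjoint_inner_right, r.incl_apply, r.incl_apply]
  have hunit : IsUnit B := by
    refine B.isUnit_of_forall_le_norm_inner_map (c := ⟨ε, hε.le⟩) hε fun v => ?_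
    rw [norm_inner_symm]
    refine le_trans ?_ (Complex.re_le_norm _)
    rw [hBi, inner_self_eq_norm_sq_to_K]
    have := hco v
    have h2 : (q.form (r.toDom v) (r.toDom v) - z * ((‖(r.toDom v : E)‖ : ℂ)) ^ 2).re
        = q.quad (r.toDom v) - z.re * ‖(r.toDom v : E)‖ ^ 2 := by
      simp [quad, ← Complex.ofReal_pow]
    change ‖v‖ ^ 2 * ε ≤ (q.form (r.toDom v) (r.toDom v) - z * ((‖(r.toDom v : E)‖ : ℂ)) ^ 2).re
    rw [h2]; linarith
  obtain ⟨S, hS⟩ := hunit.exists_right_inv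
  refine ⟨r.incl ∘L S ∘L r.incl.adjoint, fun f => ?_⟩
  have hRf : (r.incl ∘L S ∘L r.incl.adjoint) f = (r.toDom (S (r.incl.adjoint f)) : E) :=
    r.incl_apply _
  refine ⟨hRf ▸ Subtype.prop _, fun v => ?_⟩
  obtain ⟨v, rfl⟩ := r.surj v
  have hsub : (⟨(r.incl ∘L S ∘L r.incl.adjoint) f, hRf ▸ Subtype.prop _⟩ : q.dom)
      = r.toDom (S (r.incl.adjoint f)) := Subtype.ext hRf
  rw [hsub, hRf, ← hBi]
  have h1 : B (S (r.incl.adjoint f)) = r.incl.adjoint f := by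
    exact congrArg (fun T : V →L[ℂ] V => T (r.incl.adjoint f)) hS
  rw [h1, ContinuousLinearMap.adjoint_inner_right, r.incl_apply]

/-- `q.Corresponds H` only bounds `H` from above by the form, so membership in the domain has to
come from maximality: the weak equation and symmetry put `R f` in the domain of the adjoint, which
is `H`. -/
theorem IsWeakResolvent.mem_domain {z : ℂ} {R : E →L[ℂ] E} (hR : q.IsWeakResolvent z R)
    {H : E →ₗ.[ℂ] E} (hH : IsSelfAdjoint H) (hq : q.Corresponds H) (f : E) :
    ∃ h : R f ∈ H.domain, H ⟨R f, h⟩ - z • R f = f := by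
  obtain ⟨hf, hRf⟩ := hR f
  have key : ∀ x : H.domain, ⟪z • R f + f, (x : E)⟫_ℂ = ⟪R f, H x⟫_ℂ := by
    intro x
    obtain ⟨hx, hxq⟩ := hq x
    rw [← hxq ⟨R f, hf⟩, ← q.symm ⟨x, hx⟩ ⟨R f, hf⟩, ← inner_conj_symm, inner_add_right,
      inner_smul_right]
    congr 1
    linear_combination -(hRf ⟨x, hx⟩)
  have hmem : R f ∈ H.adjoint.domain := LinearPMap.mem_adjoint_domain_of_exists _ ⟨_, key⟩
  have happ : H.adjoint ⟨R f, hmem⟩ = z • R f + f :=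
    LinearPMap.adjoint_apply_eq hH.dense_domain _ key
  have hadj : H.adjoint = H := hH
  refine ⟨hadj ▸ hmem, ?_⟩
  have h2 : H.adjoint ⟨R f, hmem⟩ = H ⟨R f, hadj ▸ hmem⟩ := hadj.le.2 rfl
  rw [← h2, happ, add_sub_cancel_left]

omit [CompleteSpace E] in
theorem IsWeakResolvent.apply_sub {z : ℂ} {R : E →L[ℂ] E} (hR : q.IsWeakResolvent z R)
    (hm : ∀ u : q.dom, m * ‖(u : E)‖ ^ 2 ≤ q.quad u) (hz : z.re < m)
    {H : E →ₗ.[ℂ] E} (hq : q.Corresponds H) (u : H.domain) :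
    R (H u - z • (u : E)) = u := by
  obtain ⟨hf, hRf⟩ := hR (H u - z • (u : E))
  obtain ⟨hu, huq⟩ := hq u
  have : (⟨_, hf⟩ : q.dom) = ⟨u, hu⟩ := eq_of_forall_form_sub_eq hm hz fun v => by
    rw [hRf, huq, inner_sub_right, inner_smul_right]
  exact congrArg Subtype.val this

theorem Realization.isResolventPoint (r : q.Realization V)
    (hm : ∀ u : q.dom, m * ‖(u : E)‖ ^ 2 ≤ q.quad u) {z : ℂ} (hz : z.re < m)
    {H : E →ₗ.[ℂ] E} (hH : IsSelfAdjoint H) (hq : q.Corresponds H) : IsResolventPoint H z := by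
  obtain ⟨R, hR⟩ := r.exists_weakResolvent hm hz
  exact ⟨R, hR.mem_domain hH hq, hR.apply_sub hm hz hq⟩

theorem Realization.le_infSpectrum (r : q.Realization V)
    (hm : ∀ u : q.dom, m * ‖(u : E)‖ ^ 2 ≤ q.quad u)
    {H : E →ₗ.[ℂ] E} (hH : IsSelfAdjoint H) (hq : q.Corresponds H) :
    (m : EReal) ≤ infSpectrum H := by
  refine le_sInf ?_
  rintro _ ⟨z, hz, rfl⟩
  exact EReal.coe_le_coe_iff.mpr (not_lt.mp fun hlt => hz (r.isResolventPoint hm hlt hH hq))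

/-- One weak resolvent `R` serves both operators: `u = R (H u - z u)` lies in the domain of `H'`,
and `H'` acts on it as `H` does. With the roles exchanged this gives uniqueness. -/
theorem Realization.operator_le (r : q.Realization V)
    (hm : ∀ u : q.dom, m * ‖(u : E)‖ ^ 2 ≤ q.quad u)
    {H H' : E →ₗ.[ℂ] E} (hq : q.Corresponds H) (hH' : IsSelfAdjoint H') (hq' : q.Corresponds H') :
    H ≤ H' := by
  have hz : ((m - 1 : ℝ) : ℂ).re < m := by rw [Complex.ofReal_re]; linarith
  obtain ⟨R, hR⟩ := r.exists_weakResolvent hm hz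
  have key : ∀ u : H.domain, ∃ h : (u : E) ∈ H'.domain, H' ⟨u, h⟩ = H u := by
    intro u
    have h1 := hR.apply_sub hm hz hq u
    obtain ⟨h2, h3⟩ := hR.mem_domain hH' hq' (H u - ((m - 1 : ℝ) : ℂ) • (u : E))
    simp only [h1] at h2 h3
    exact ⟨h2, sub_left_injective h3⟩
  refine ⟨fun u hu => (key ⟨u, hu⟩).1, fun u u' huu' => ?_⟩
  obtain ⟨h, h'⟩ := key u
  rw [← h']
  exact congrArg H' (Subtype.ext huu')

omit [CompleteSpace E] in
theorem IsWeakResolvent.isSymmetric {x : ℝ} {R : E →L[ℂ] E} (hR : q.IsWeakResolvent x R) (f g : E) :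
    ⟪R f, g⟫_ℂ = ⟪f, R g⟫_ℂ := by
  obtain ⟨hf, hRf⟩ := hR f
  obtain ⟨hg, hRg⟩ := hR g
  rw [← hRg ⟨R f, hf⟩, ← inner_conj_symm f, ← hRf ⟨R g, hg⟩, map_sub, map_mul, q.symm,
    inner_conj_symm, Complex.conj_ofReal]

omit [CompleteSpace E] in
theorem IsWeakResolvent.injective {z : ℂ} {R : E →L[ℂ] E} (hR : q.IsWeakResolvent z R)
    (hd : Dense (q.dom : Set E)) : Function.Injective R := by
  rw [injective_iff_map_eq_zero]
  intro f hf
  obtain ⟨h, hRf⟩ := hR f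
  have h0 : (⟨R f, h⟩ : q.dom) = 0 := Subtype.ext hf
  refine hd.eq_zero_of_inner_right ℂ fun v hv => ?_
  rw [← hRf ⟨v, hv⟩, h0, hf]
  simp

/-- The operator is `R⁻¹ + x` on the range of a weak resolvent `R` at a real point `x < m`; it is
self-adjoint because `R` is bounded, symmetric and injective. -/
theorem Realization.exists_operator (r : q.Realization V)
    (hm : ∀ u : q.dom, m * ‖(u : E)‖ ^ 2 ≤ q.quad u) (hd : Dense (q.dom : Set E)) :
    ∃ H : E →ₗ.[ℂ] E, IsSelfAdjoint H ∧ q.Corresponds H := by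
  obtain ⟨x, hx⟩ := exists_lt m
  obtain ⟨R, hR⟩ := r.exists_weakResolvent hm (z := (x : ℂ)) (by rwa [Complex.ofReal_re])
  have hinj := hR.injective hd
  set eq := LinearEquiv.ofInjective (R : E →ₗ[ℂ] E) hinj with heq
  set H : E →ₗ.[ℂ] E :=
    ⟨LinearMap.range (R : E →ₗ[ℂ] E), (eq.symm : _ →ₗ[ℂ] E) + (x : ℂ) • Submodule.subtype _⟩ with hH
  have hmemH : ∀ f, R f ∈ H.domain := fun f => LinearMap.mem_range_self _ f
  have hHR : ∀ f, H ⟨R f, hmemH f⟩ = f + (x : ℂ) • R f := by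
    intro f
    change eq.symm ⟨R f, hmemH f⟩ + (x : ℂ) • R f = _
    congr 1
    exact eq.symm_apply_apply f
  have hsurj : ∀ u : H.domain, ∃ f, u = ⟨R f, hmemH f⟩ := by
    rintro ⟨u, f, rfl⟩; exact ⟨f, rfl⟩
  have hdense : Dense (H.domain : Set E) := by
    rw [Submodule.dense_iff_topologicalClosure_eq_top, Submodule.topologicalClosure_eq_top_iff,
      Submodule.eq_bot_iff]
    -- A vector orthogonal to the range of the symmetric `R` is in its kernel, which is trivial.
    intro f hf
    apply hinj
    rw [map_zero]
    refine ext_inner_left ℂ fun g => ?_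
    rw [← hR.isSymmetric, inner_zero_right]
    exact (Submodule.mem_orthogonal _ _).mp hf _ (hmemH g)
  have hsym : H.IsFormalAdjoint H := by
    intro u v
    obtain ⟨f, rfl⟩ := hsurj u
    obtain ⟨g, rfl⟩ := hsurj v
    rw [hHR, hHR, inner_add_left, inner_add_right, inner_smul_left, inner_smul_right,
      Complex.conj_ofReal, hR.isSymmetric f g]
  refine ⟨H, ?_, ?_⟩
  · rw [LinearPMap.isSelfAdjoint_def]
    refine le_antisymm ?_ (hsym.le_adjoint hdense)
    have key : ∀ y : H.adjoint.domain, ∃ h : (y : E) ∈ H.domain, H ⟨y, h⟩ = H.adjoint y := by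
      intro y
      -- Were `y` in the domain of `H`, it would equal `R (H y - x y)`; the same formula with the
      -- adjoint shows that it lies in the range of `R`.
      set g := H.adjoint y - (x : ℂ) • (y : E) with hg
      have hy : (y : E) = R g := by
        refine ext_inner_right ℂ fun f => ?_
        have h1 := LinearPMap.adjoint_isFormalAdjoint hdense y ⟨R f, hmemH f⟩
        rw [hHR, inner_add_right, inner_smul_right] at h1
        rw [hR.isSymmetric, hg, inner_sub_left, inner_smul_left, Complex.conj_ofReal]
        linear_combination -h1
      have h2 : (y : E) ∈ H.domain := hy ▸ hmemH g
      refine ⟨h2, ?_⟩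
      have h3 : (⟨y, h2⟩ : H.domain) = ⟨R g, hmemH g⟩ := Subtype.ext hy
      rw [h3, hHR, ← hy, hg, sub_add_cancel]
    refine ⟨fun y hy => (key ⟨y, hy⟩).1, fun y y' hyy' => ?_⟩
    obtain ⟨h, h'⟩ := key y
    rw [← h']
    exact congrArg H (Subtype.ext hyy')
  · intro u
    obtain ⟨f, rfl⟩ := hsurj u
    obtain ⟨h, hRf⟩ := hR f
    refine ⟨h, fun v => ?_⟩
    rw [hHR, inner_add_right, inner_smul_right, ← hRf v]
    ring

theorem Realization.existsUnique_operator (r : q.Realization V)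
    (hm : ∀ u : q.dom, m * ‖(u : E)‖ ^ 2 ≤ q.quad u) (hd : Dense (q.dom : Set E)) :
    ∃! H : E →ₗ.[ℂ] E, IsSelfAdjoint H ∧ q.Corresponds H := by
  obtain ⟨H, hH⟩ := r.exists_operator hm hd
  exact ⟨H, hH, fun H' hH' => le_antisymm (r.operator_le hm hH'.2 hH.1 hH.2)
    (r.operator_le hm hH.2 hH'.1 hH'.2)⟩

omit [CompleteSpace E] in
-- Coercivity upgrades convergence in `E` together with `q[uₙ - uₘ] → 0` to the Cauchy property in
-- the complete space `V`, on which the form is continuous.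
theorem Realization.isClosed (r : q.Realization V) : q.IsClosed := by
  intro u w huw hq
  choose v hv using fun n => r.surj (u n)
  have hcau : CauchySeq v := by
    rw [cauchySeq_iff_tendsto_dist_atTop_0]
    have h1 : Tendsto (fun p : ℕ × ℕ => ‖(u p.1 : E) - u p.2‖) atTop (𝓝 0) := by
      simpa only [dist_eq_norm] using cauchySeq_iff_tendsto_dist_atTop_0.mp huw.cauchySeq
    have h2 : Tendsto (fun p : ℕ × ℕ =>
        √(r.δ⁻¹ * (q.quad (u p.1 - u p.2) + r.b * ‖(u p.1 : E) - u p.2‖ ^ 2))) atTop (𝓝 0) := by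
      have := ((hq.add ((h1.pow 2).const_mul r.b)).const_mul r.δ⁻¹).sqrt
      simpa using this
    refine squeeze_zero (fun _ => dist_nonneg) (fun p => ?_) h2
    apply Real.le_sqrt_of_sq_le
    have := r.coercive (v p.1 - v p.2)
    rw [map_sub, hv, hv, Submodule.coe_sub] at this
    rw [dist_eq_norm, ← mul_le_mul_iff_right₀ r.δ_pos, mul_inv_cancel_left₀ r.δ_pos.ne']
    exact this
  obtain ⟨v₀, hv₀⟩ := cauchySeq_tendsto_of_complete hcau
  have hlim : (r.toDom v₀ : E) = w := by
    refine tendsto_nhds_unique ?_ huw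
    have := (r.incl.continuous.tendsto v₀).comp hv₀
    simpa [Function.comp_def, r.incl_apply, hv] using this
  subst hlim
  refine ⟨Subtype.prop _, ?_⟩
  have hquad : ∀ v, q.quad (r.toDom v) = (⟪v, r.op v⟫_ℂ).re := fun v => by rw [r.inner_op]; rfl
  have h3 : (fun n => q.quad (u n - ⟨(r.toDom v₀ : E), Subtype.prop _⟩))
      = fun n => (⟪v n - v₀, r.op (v n - v₀)⟫_ℂ).re := by
    funext n
    rw [← hquad, map_sub, hv]
  rw [h3]
  have h4 : Continuous fun v : V => (⟪v - v₀, r.op (v - v₀)⟫_ℂ).re := by fun_prop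
  simpa [Function.comp_def] using (h4.tendsto v₀).comp hv₀

end SymForm

end FormTheory

/-! ### `H¹(ℝ²)` as a Hilbert space -/

/-- Both the embedding of `L²` into tempered distributions and the distributional derivative are
continuous. This closedness is what makes `H¹` complete. -/
theorem isClosed_hasWeakPartial (i : Fin 2) : _root_.IsClosed {p : L2 × L2 | HasWeakPartial i p.1 p.2} := by
  have h : Continuous (Lp.toTemperedDistributionCLM ℂ (volume : Measure Plane) 2) :=
    ContinuousLinearMap.continuous _
  have h2 : Continuous fun f : 𝓢'(Plane, ℂ) => ∂_{e i} f := LineDeriv.continuous_lineDerivOp _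
  exact isClosed_eq (h2.comp (h.comp continuous_fst)) (h.comp continuous_snd)

/-- The ambient Hilbert space of triples `(u, ∂₀u, ∂₁u)`. -/
abbrev Jet : Type := WithLp 2 (L2 × PiLp 2 (fun _ : Fin 2 => L2))

/-- `u ↦ (u, ∂₀u, ∂₁u)`. -/
def jet : H1 →ₗ[ℂ] Jet where
  toFun u := WithLp.toLp 2 ((u : L2), WithLp.toLp 2 fun i => partialDeriv i u)
  map_add' u v := by
    refine WithLp.ofLp_injective 2 (Prod.ext rfl (WithLp.ofLp_injective 2 (funext fun i => ?_)))
    exact map_add (partialDeriv i) u v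
  map_smul' a u := by
    refine WithLp.ofLp_injective 2 (Prod.ext rfl (WithLp.ofLp_injective 2 (funext fun i => ?_)))
    exact map_smul (partialDeriv i) a u

theorem jet_injective : Function.Injective jet := fun u v h => by
  have := congrArg (fun p : Jet => p.fst) h
  exact Subtype.ext this

/-- The subspace of the jets `(u, ∂₀u, ∂₁u)` with `u` in `H¹(ℝ²)`. -/
def jetRange : Submodule ℂ Jet := LinearMap.range jet

/-- The Hilbert space of the jets `(u, ∂₀u, ∂₁u)` with `u` in `H¹(ℝ²)`. -/
abbrev SobolevSpace : Type := jetRange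

theorem HasWeakPartial.mem_H1 {u : L2} {g : Fin 2 → L2} (h : ∀ i, HasWeakPartial i u (g i)) :
    ∃ hu : u ∈ H1, ∀ i, partialDeriv i ⟨u, hu⟩ = g i :=
  ⟨fun i => ⟨g i, h i⟩, fun i => (partialDeriv_spec i _).unique (h i)⟩

theorem jetRange_eq : (jetRange : Set Jet)
    = ⋂ i : Fin 2, {p : Jet | HasWeakPartial i p.fst (p.snd i)} := by
  ext p
  simp only [mem_iInter, mem_ofPred_eq]
  constructor
  · rintro ⟨u, rfl⟩ i
    exact partialDeriv_spec i u
  · intro hp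
    obtain ⟨hu, hg⟩ := HasWeakPartial.mem_H1 hp
    refine ⟨⟨p.fst, hu⟩, ?_⟩
    exact WithLp.ofLp_injective 2 (Prod.ext rfl (WithLp.ofLp_injective 2 (funext hg)))

theorem isComplete_jetRange : IsComplete (jetRange : Set Jet) := by
  rw [jetRange_eq]
  refine _root_.IsClosed.isComplete (isClosed_iInter fun i => ?_)
  have h : Continuous fun p : Jet => (p.fst, p.snd i) :=
    (WithLp.fstL 2 ℂ L2 (PiLp 2 (fun _ : Fin 2 => L2))).continuous.prodMk
      ((PiLp.proj (𝕜 := ℂ) 2 (fun _ : Fin 2 => L2) i).continuous.comp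
        (WithLp.sndL 2 ℂ L2 (PiLp 2 (fun _ : Fin 2 => L2))).continuous)
  exact (isClosed_hasWeakPartial i).preimage h

instance : CompleteSpace SobolevSpace := isComplete_jetRange.completeSpace_coe

/-- The identification of `H¹(ℝ²)` with a Hilbert space. -/
def sobolevEquiv : H1 ≃ₗ[ℂ] SobolevSpace := LinearEquiv.ofInjective jet jet_injective

theorem inner_sobolevEquiv (u v : H1) : ⟪sobolevEquiv u, sobolevEquiv v⟫_ℂ
    = ⟪(u : L2), (v : L2)⟫_ℂ + ∑ i, ⟪partialDeriv i u, partialDeriv i v⟫_ℂ := by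
  change ⟪jet u, jet v⟫_ℂ = _
  rw [WithLp.prod_inner_apply, PiLp.inner_apply]
  rfl

theorem norm_sobolevEquiv_sq (u : H1) : ‖sobolevEquiv u‖ ^ 2 = gradNormSq u + ‖(u : L2)‖ ^ 2 := by
  change ‖jet u‖ ^ 2 = _
  rw [WithLp.prod_norm_sq_eq_of_L2, add_comm]
  congr 1
  exact PiLp.norm_sq_eq_of_L2 _ _

/-- The inclusion of `H¹(ℝ²)` into `L²(ℝ²)`. -/
def sobolevIncl : SobolevSpace →L[ℂ] L2 :=
  (WithLp.fstL 2 ℂ L2 (PiLp 2 (fun _ : Fin 2 => L2))) ∘L jetRange.subtypeL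

theorem sobolevIncl_apply (v : SobolevSpace) : sobolevIncl v = (sobolevEquiv.symm v : L2) := by
  obtain ⟨u, rfl⟩ := sobolevEquiv.surjective v
  rw [sobolevEquiv.symm_apply_apply]
  rfl

/-! ### Density of Schwartz functions in `H¹` -/

/-- The map from Schwartz functions to the Hilbert space `H¹(ℝ²)`. -/
def schwartzToSobolev : 𝓢(Plane, ℂ) →ₗ[ℂ] SobolevSpace :=
  sobolevEquiv.toLinearMap ∘ₗ
    { toFun := schwartzToH1
      map_add' := fun _ _ => rfl
      map_smul' := fun _ _ => rfl }

theorem schwartzToSobolev_apply (ψ : 𝓢(Plane, ℂ)) :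
    schwartzToSobolev ψ = sobolevEquiv (schwartzToH1 ψ) := rfl

theorem partialDeriv_schwartz (i : Fin 2) (ψ : 𝓢(Plane, ℂ)) :
    partialDeriv i (schwartzToH1 ψ) = (∂_{e i} ψ).toLp 2 volume := by
  refine (partialDeriv_spec i _).unique ?_
  change HasWeakPartial i (ψ.toLp 2 volume) _
  unfold HasWeakPartial
  rw [Lp.toTemperedDistribution_toLp_eq, Lp.toTemperedDistribution_toLp_eq]
  exact TemperedDistribution.lineDerivOp_toTemperedDistributionCLM_eq ψ (e i)

/-- Complex conjugation of Schwartz functions. -/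
def schwartzConj : 𝓢(Plane, ℂ) →L[ℝ] 𝓢(Plane, ℂ) :=
  SchwartzMap.postcompCLM (Complex.conjCLE : ℂ →L[ℝ] ℂ)

theorem schwartzConj_apply (ψ : 𝓢(Plane, ℂ)) (x : Plane) : schwartzConj ψ x = conj (ψ x) := rfl

theorem lineDeriv_schwartzConj (ψ : 𝓢(Plane, ℂ)) (m x : Plane) :
    (∂_{m} (schwartzConj ψ)) x = conj ((∂_{m} ψ) x) := by
  rw [SchwartzMap.lineDerivOp_apply_eq_fderiv, SchwartzMap.lineDerivOp_apply_eq_fderiv]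
  have h : (schwartzConj ψ : Plane → ℂ) = (Complex.conjCLE : ℂ →L[ℝ] ℂ) ∘ ψ := rfl
  rw [h, ((Complex.conjCLE : ℂ →L[ℝ] ℂ).hasFDerivAt.comp x ψ.differentiableAt.hasFDerivAt).fderiv]
  rfl

theorem inner_toLp_left (ψ : 𝓢(Plane, ℂ)) (u : L2) :
    ⟪ψ.toLp 2 volume, u⟫_ℂ = ∫ x, conj (ψ x) * u x := by
  rw [L2.inner_def]
  refine integral_congr_ae ?_
  filter_upwards [ψ.coeFn_toLp 2 volume] with x hx
  rw [hx, RCLike.inner_apply, mul_comm]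

theorem HasWeakPartial.inner_eq {i : Fin 2} {u g : L2} (h : HasWeakPartial i u g)
    (ψ : 𝓢(Plane, ℂ)) :
    ⟪ψ.toLp 2 volume, g⟫_ℂ = - ⟪(∂_{e i} ψ).toLp 2 volume, u⟫_ℂ := by
  have := (hasWeakPartial_iff i u g).mp h (schwartzConj ψ)
  simp only [lineDeriv_schwartzConj, schwartzConj_apply] at this
  rw [inner_toLp_left, inner_toLp_left, this, neg_neg]

theorem fourier_lineDeriv_apply (φ : 𝓢(Plane, ℂ)) (i : Fin 2) (ξ : Plane) :
    (𝓕 (∂_{e i} φ) : 𝓢(Plane, ℂ)) ξ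
      = (2 * Real.pi * Complex.I) * ((ξ i : ℝ) * (𝓕 φ : 𝓢(Plane, ℂ)) ξ) := by
  have h1 : (fun x : Plane => inner ℝ x (e i)).HasTemperateGrowth := by fun_prop
  rw [SchwartzMap.fourier_lineDerivOp_eq, _root_.smul_apply,
    SchwartzMap.smulLeftCLM_apply_apply h1]
  simp [e, EuclideanSpace.inner_single_right]

/-- The Fourier multiplier `(1 + 4π²|ξ|²)⁻¹` has temperate growth, so it maps Schwartz functions to
Schwartz functions and inverts `1 - Δ` there. -/
theorem exists_sub_laplacian_eq (φ : 𝓢(Plane, ℂ)) :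
    ∃ ψ : 𝓢(Plane, ℂ), ψ - ∑ i, ∂_{e i} (∂_{e i} ψ) = φ := by
  set g : Plane → ℝ := fun x => (1 + ‖(2 * Real.pi) • x‖ ^ 2) ^ (-1 : ℝ) with hg
  have hgt : g.HasTemperateGrowth := by
    have h1 : (fun x : Plane => (2 * Real.pi) • x).HasTemperateGrowth := by fun_prop
    exact (Function.hasTemperateGrowth_one_add_norm_sq_rpow Plane (-1)).comp h1
  refine ⟨SchwartzMap.fourierMultiplierCLM ℂ g φ, ?_⟩
  set ψ := SchwartzMap.fourierMultiplierCLM ℂ g φ with hψ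
  have hF : ∀ ξ, (𝓕 ψ : 𝓢(Plane, ℂ)) ξ = g ξ • (𝓕 φ : 𝓢(Plane, ℂ)) ξ := by
    intro ξ
    rw [hψ, SchwartzMap.fourierMultiplierCLM_apply, FourierTransform.fourier_fourierInv_eq,
      SchwartzMap.smulLeftCLM_apply_apply hgt]
  have hinj : Function.Injective (𝓕 : 𝓢(Plane, ℂ) → 𝓢(Plane, ℂ)) := by
    intro a b hab
    have := congrArg (𝓕⁻ : 𝓢(Plane, ℂ) → 𝓢(Plane, ℂ)) hab
    simpa using this
  apply hinj
  ext ξ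
  have hsub : (𝓕 (ψ - ∑ i, ∂_{e i} (∂_{e i} ψ)) : 𝓢(Plane, ℂ))
      = 𝓕 ψ
        - ∑ i, 𝓕 (∂_{e i} (∂_{e i} ψ)) := by
    have : ∀ f : 𝓢(Plane, ℂ), 𝓕 f
      = FourierTransform.fourierCLM ℂ 𝓢(Plane, ℂ) f := fun f => rfl
    simp only [this, map_sub, map_sum]
  rw [hsub, _root_.sub_apply, _root_.sum_apply]
  simp only [fourier_lineDeriv_apply, hF]
  have hpos : (0 : ℝ) < 1 + ‖(2 * Real.pi) • ξ‖ ^ 2 := by positivity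
  have hn : ‖(2 * Real.pi) • ξ‖ ^ 2 = 4 * Real.pi ^ 2 * (ξ 0 ^ 2 + ξ 1 ^ 2) := by
    rw [norm_smul, mul_pow, EuclideanSpace.real_norm_sq_eq, Fin.sum_univ_two, Real.norm_eq_abs, sq_abs]
    ring
  have hg1 : (g ξ : ℂ) * (1 + 4 * Real.pi ^ 2 * ((ξ 0 : ℂ) ^ 2 + (ξ 1 : ℂ) ^ 2)) = 1 := by
    have : g ξ * (1 + 4 * Real.pi ^ 2 * (ξ 0 ^ 2 + ξ 1 ^ 2)) = 1 := by
      rw [hg, ← hn]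
      simp only [Real.rpow_neg_one]
      exact inv_mul_cancel₀ hpos.ne'
    exact_mod_cast this
  rw [Fin.sum_univ_two, Complex.real_smul]
  linear_combination ((𝓕 φ : 𝓢(Plane, ℂ)) ξ) * hg1
    - 4 * Real.pi ^ 2 * (g ξ) * ((𝓕 φ : 𝓢(Plane, ℂ)) ξ) * ((ξ 0 : ℂ) ^ 2 + (ξ 1 : ℂ) ^ 2)
      * Complex.I_sq

theorem denseRange_toLp : DenseRange fun ψ : 𝓢(Plane, ℂ) => ψ.toLp 2 (volume : Measure Plane) :=
  SchwartzMap.denseRange_toLpCLM ENNReal.ofNat_ne_top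

theorem dense_H1 : Dense (H1 : Set L2) :=
  denseRange_toLp.mono (by rintro _ ⟨ψ, rfl⟩; exact schwartz_mem_H1 ψ)

/-- If `u` is `H¹`-orthogonal to every Schwartz `ψ`, integration by parts makes it `L²`-orthogonal
to every `ψ - Δψ`. These exhaust the Schwartz functions, which are dense in `L²`. -/
theorem denseRange_schwartzToSobolev : DenseRange schwartzToSobolev := by
  have : Dense (LinearMap.range schwartzToSobolev : Set SobolevSpace) := by
    rw [Submodule.dense_iff_topologicalClosure_eq_top]
    refine (Submodule.topologicalClosure_eq_top_iff (𝕜 := ℂ) (E := SobolevSpace)).mpr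
      ((Submodule.eq_bot_iff _).mpr fun v hv => ?_)
    obtain ⟨u, rfl⟩ := sobolevEquiv.surjective v
    rw [LinearEquiv.map_eq_zero_iff]
    refine Subtype.ext (denseRange_toLp.eq_zero_of_inner_right ℂ fun φ => ?_)
    obtain ⟨ψ, rfl⟩ := exists_sub_laplacian_eq φ
    have h1 := (Submodule.mem_orthogonal _ _).mp hv _ (LinearMap.mem_range_self _ ψ)
    rw [schwartzToSobolev_apply, inner_sobolevEquiv] at h1
    simp only [partialDeriv_schwartz, (partialDeriv_spec _ u).inner_eq] at h1
    have h2 : ∀ f : 𝓢(Plane, ℂ), f.toLp 2 (volume : Measure Plane)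
      = SchwartzMap.toLpCLM ℂ ℂ 2 volume f := fun f => rfl
    simp only [h2, map_sub, map_sum, inner_sub_left, sum_inner]
    rw [← h1, sub_eq_add_neg, ← Finset.sum_neg_distrib]
    rfl
  exact this

/-! ### The trace operator and the form -/

/-- The trace inequality `α ‖ψ‖²_{L²(Γ)} ≤ ‖∇ψ‖² + M(α) ‖ψ‖²` for Schwartz functions. -/
def HasTraceBound (Γ : Set Plane) (M : ℝ → ℝ) : Prop :=
  ∀ α : ℝ, 0 < α → ∀ ψ : 𝓢(Plane, ℂ),
    ENNReal.ofReal α * ∫⁻ x, ‖ψ x‖ₑ ^ 2 ∂(lengthMeasure Γ) ≤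
      ENNReal.ofReal (gradNormSq (schwartzToH1 ψ) + M α * ‖ψ.toLp 2 (volume : Measure Plane)‖ ^ 2)

variable {Γ : Set Plane} {M : ℝ → ℝ}

theorem gradNormSq_nonneg (u : H1) : 0 ≤ gradNormSq u :=
  Finset.sum_nonneg fun _ _ => sq_nonneg _

theorem eLpNorm_two_sq {X : Type*} [MeasurableSpace X] (μ : Measure X) (f : X → ℂ) :
    eLpNorm f 2 μ ^ 2 = ∫⁻ x, ‖f x‖ₑ ^ 2 ∂μ := by
  have := eLpNorm_nnreal_pow_eq_lintegral (f := f) (μ := μ) (p := 2) two_ne_zero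
  simpa using this

theorem HasTraceBound.memLp (h : HasTraceBound Γ M) (ψ : 𝓢(Plane, ℂ)) :
    MemLp ψ 2 (lengthMeasure Γ) := by
  refine ⟨ψ.continuous.aestronglyMeasurable, ?_⟩
  have h1 := (h 1 one_pos ψ).trans_lt ENNReal.ofReal_lt_top
  rw [ENNReal.ofReal_one, one_mul, ← eLpNorm_two_sq] at h1
  exact (ENNReal.pow_lt_top_iff.mp h1).resolve_right two_ne_zero

theorem HasTraceBound.norm_toLp_sq_le (h : HasTraceBound Γ M) (hM : ∀ α, 0 ≤ M α) {α : ℝ}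
    (hα : 0 < α) (ψ : 𝓢(Plane, ℂ)) :
    α * ‖(h.memLp ψ).toLp ψ‖ ^ 2 ≤
      gradNormSq (schwartzToH1 ψ) + M α * ‖(schwartzToH1 ψ : L2)‖ ^ 2 := by
  have h1 := h α hα ψ
  rw [← eLpNorm_two_sq] at h1
  have h2 : 0 ≤ gradNormSq (schwartzToH1 ψ) + M α * ‖ψ.toLp 2 (volume : Measure Plane)‖ ^ 2 :=
    add_nonneg (gradNormSq_nonneg _) (mul_nonneg (hM α) (sq_nonneg _))
  have h3 := ENNReal.toReal_mono ENNReal.ofReal_ne_top h1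
  rw [ENNReal.toReal_mul, ENNReal.toReal_pow, ENNReal.toReal_ofReal hα.le,
    ENNReal.toReal_ofReal h2] at h3
  rw [Lp.norm_toLp]
  exact h3

/-- The restriction of Schwartz functions to `Γ`. -/
def HasTraceBound.restrict (h : HasTraceBound Γ M) : 𝓢(Plane, ℂ) →ₗ[ℂ] L2On Γ where
  toFun ψ := (h.memLp ψ).toLp ψ
  map_add' _ _ := rfl
  map_smul' _ _ := rfl

theorem HasTraceBound.norm_restrict_le (h : HasTraceBound Γ M) (hM : ∀ α, 0 ≤ M α)
    (ψ : 𝓢(Plane, ℂ)) : ‖h.restrict ψ‖ ≤ √(1 + M 1) * ‖schwartzToSobolev ψ‖ := by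
  have h1 := h.norm_toLp_sq_le hM one_pos ψ
  have h2 := norm_sobolevEquiv_sq (schwartzToH1 ψ)
  have h3 := mul_nonneg (hM 1) (gradNormSq_nonneg (schwartzToH1 ψ))
  refine le_of_sq_le_sq ?_ (by positivity)
  rw [mul_pow, Real.sq_sqrt (by linarith [hM 1]), schwartzToSobolev_apply, h2]
  change ‖(h.memLp ψ).toLp ψ‖ ^ 2 ≤ _
  nlinarith [sq_nonneg ‖(schwartzToH1 ψ : L2)‖]

/-- A trace operator as a bounded operator on the Hilbert space `H¹(ℝ²)`. -/
theorem IsTraceOperator.exists_continuous {T : H1 →ₗ[ℂ] L2On Γ} (hT : IsTraceOperator Γ T) :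
    ∃ S : SobolevSpace →L[ℂ] L2On Γ, ∀ u, S (sobolevEquiv u) = T u := by
  obtain ⟨⟨C, hC⟩, -⟩ := hT
  refine ⟨(T ∘ₗ sobolevEquiv.symm.toLinearMap).mkContinuous √|C| fun v => ?_, fun u => ?_⟩
  · obtain ⟨u, rfl⟩ := sobolevEquiv.surjective v
    refine le_of_sq_le_sq ?_ (by positivity)
    have h1 : T (sobolevEquiv.symm (sobolevEquiv u)) = T u := by
      rw [LinearEquiv.symm_apply_apply]
    rw [mul_pow, Real.sq_sqrt (abs_nonneg _), norm_sobolevEquiv_sq]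
    change ‖T (sobolevEquiv.symm (sobolevEquiv u))‖ ^ 2 ≤ _
    rw [h1]
    refine (hC u).trans (mul_le_mul_of_nonneg_right (le_abs_self C) ?_)
    have := gradNormSq_nonneg u
    positivity
  · change T (sobolevEquiv.symm (sobolevEquiv u)) = T u
    rw [LinearEquiv.symm_apply_apply]

theorem IsTraceOperator.apply_schwartz {T : H1 →ₗ[ℂ] L2On Γ} (hT : IsTraceOperator Γ T)
    (h : HasTraceBound Γ M) (ψ : 𝓢(Plane, ℂ)) : T (schwartzToH1 ψ) = h.restrict ψ :=
  Lp.ext ((hT.2 ψ).trans (h.memLp ψ).coeFn_toLp.symm)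

theorem HasTraceBound.existsUnique (h : HasTraceBound Γ M) (hM : ∀ α, 0 ≤ M α) :
    ∃! T : H1 →ₗ[ℂ] L2On Γ, IsTraceOperator Γ T := by
  set S := h.restrict.extendOfNorm schwartzToSobolev with hS
  have hSψ : ∀ ψ, S (schwartzToSobolev ψ) = h.restrict ψ :=
    LinearMap.extendOfNorm_eq denseRange_schwartzToSobolev ⟨_, h.norm_restrict_le hM⟩
  refine ⟨S.toLinearMap ∘ₗ sobolevEquiv.toLinearMap, ⟨⟨‖S‖ ^ 2, fun u => ?_⟩, fun ψ => ?_⟩, ?_⟩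
  · rw [← norm_sobolevEquiv_sq, ← mul_pow]
    exact pow_le_pow_left₀ (norm_nonneg _) (S.le_opNorm _) 2
  · change S (schwartzToSobolev ψ) =ᵐ[_] _
    rw [hSψ]
    exact (h.memLp ψ).coeFn_toLp
  · intro T hT
    obtain ⟨S', hS'⟩ := hT.exists_continuous
    have hSS : S' = S := by
      refine DFunLike.coe_injective
        (denseRange_schwartzToSobolev.equalizer S'.continuous S.continuous ?_)
      funext ψ
      change S' (sobolevEquiv (schwartzToH1 ψ)) = S (schwartzToSobolev ψ)
      rw [hS', hSψ, hT.apply_schwartz h]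
    ext1 u
    rw [← hS', hSS]
    rfl

theorem IsTraceOperator.norm_sq_le {T : H1 →ₗ[ℂ] L2On Γ} (hT : IsTraceOperator Γ T)
    (h : HasTraceBound Γ M) (hM : ∀ α, 0 ≤ M α) {α : ℝ} (hα : 0 < α) (u : H1) :
    α * ‖T u‖ ^ 2 ≤ gradNormSq u + M α * ‖(u : L2)‖ ^ 2 := by
  obtain ⟨S, hS⟩ := hT.exists_continuous
  -- The gradient term is rewritten as `‖v‖² - ‖sobolevIncl v‖²`, so that both sides are continuous
  -- on the Sobolev space and the inequality passes from Schwartz functions to the closure.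
  have key : ∀ v : SobolevSpace, α * ‖S v‖ ^ 2 ≤ ‖v‖ ^ 2 + (M α - 1) * ‖sobolevIncl v‖ ^ 2 := by
    intro v
    refine denseRange_schwartzToSobolev.induction_on (p := fun v : SobolevSpace =>
      α * ‖S v‖ ^ 2 ≤ ‖v‖ ^ 2 + (M α - 1) * ‖sobolevIncl v‖ ^ 2) v ?_ fun ψ => ?_
    · exact isClosed_le (by fun_prop) (by fun_prop)
    · rw [schwartzToSobolev_apply, hS, norm_sobolevEquiv_sq, sobolevIncl_apply,
        LinearEquiv.symm_apply_apply, hT.apply_schwartz h]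
      have : α * ‖h.restrict ψ‖ ^ 2 ≤ _ := h.norm_toLp_sq_le hM hα ψ
      linarith
  have h1 := key (sobolevEquiv u)
  rw [hS, norm_sobolevEquiv_sq, sobolevIncl_apply, LinearEquiv.symm_apply_apply] at h1
  linarith

theorem IsTraceOperator.le_quad {T : H1 →ₗ[ℂ] L2On Γ} (hT : IsTraceOperator Γ T)
    (h : HasTraceBound Γ M) (hM : ∀ α, 0 ≤ M α) {α : ℝ} (hα : 0 < α) (u : (deltaForm α T).dom) :
    -(M α) * ‖(u : L2)‖ ^ 2 ≤ (deltaForm α T).quad u := by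
  have h1 := hT.norm_sq_le h hM hα u
  have h2 := deltaForm_quad α T u
  linarith

/-- The bounded operator `1 - ι* ι - α S* S`. -/
def perturbedIdentity {V E F : Type*} [NormedAddCommGroup V] [InnerProductSpace ℂ V]
    [CompleteSpace V] [NormedAddCommGroup E] [InnerProductSpace ℂ E] [CompleteSpace E]
    [NormedAddCommGroup F] [InnerProductSpace ℂ F] [CompleteSpace F]
    (ι : V →L[ℂ] E) (α : ℝ) (S : V →L[ℂ] F) : V →L[ℂ] V :=
  ContinuousLinearMap.id ℂ V - ι.adjoint ∘L ι - (α : ℂ) • (S.adjoint ∘L S)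

/-- With `ι` the inclusion into `L²` and `S` the trace, subtracting `⟪ι v, ι w⟫` strips the `L²`
part from the Sobolev inner product and leaves the gradient term of `deltaForm`. -/
theorem inner_perturbedIdentity {V E F : Type*} [NormedAddCommGroup V] [InnerProductSpace ℂ V]
    [CompleteSpace V] [NormedAddCommGroup E] [InnerProductSpace ℂ E] [CompleteSpace E]
    [NormedAddCommGroup F] [InnerProductSpace ℂ F] [CompleteSpace F]
    (ι : V →L[ℂ] E) (α : ℝ) (S : V →L[ℂ] F) (v w : V) :
    ⟪v, perturbedIdentity ι α S w⟫_ℂ = ⟪v, w⟫_ℂ - ⟪ι v, ι w⟫_ℂ - (α : ℂ) * ⟪S v, S w⟫_ℂ := by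
  have h1 : perturbedIdentity ι α S w = w - ι.adjoint (ι w) - (α : ℂ) • S.adjoint (S w) := rfl
  rw [h1, inner_sub_right, inner_sub_right, inner_smul_right,
    ContinuousLinearMap.adjoint_inner_right, ContinuousLinearMap.adjoint_inner_right]

/-- The form `q_{α,Γ}` is realized on the Hilbert space `H¹(ℝ²)`. -/
def IsTraceOperator.realization {T : H1 →ₗ[ℂ] L2On Γ} (hT : IsTraceOperator Γ T)
    (h : HasTraceBound Γ M) (hM : ∀ α, 0 ≤ M α) {α : ℝ} (hα : 0 < α) :
    (deltaForm α T).Realization SobolevSpace where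
  toDom := sobolevEquiv.symm.toLinearMap
  surj := sobolevEquiv.symm.surjective
  incl := sobolevIncl
  incl_apply := sobolevIncl_apply
  op := perturbedIdentity (V := SobolevSpace) (E := L2) (F := L2On Γ) sobolevIncl α
    hT.exists_continuous.choose
  inner_op v w := by
    have hS := hT.exists_continuous.choose_spec
    obtain ⟨v, rfl⟩ := sobolevEquiv.surjective v
    obtain ⟨w, rfl⟩ := sobolevEquiv.surjective w
    refine (inner_perturbedIdentity (V := SobolevSpace) (E := L2) (F := L2On Γ) _ _ _ _ _).trans ?_
    rw [hS, hS, inner_sobolevEquiv, sobolevIncl_apply, sobolevIncl_apply]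
    have h1 := deltaForm_apply α T (sobolevEquiv.symm (sobolevEquiv v))
      (sobolevEquiv.symm (sobolevEquiv w))
    refine Eq.trans ?_ h1.symm
    rw [LinearEquiv.symm_apply_apply, LinearEquiv.symm_apply_apply]
    ring
  δ := 1 / 2
  δ_pos := by norm_num
  -- The trace bound at `2α`, halved, spends only half of the gradient term; the extra `1 / 2`
  -- supplies the `L²` part of half the Sobolev norm.
  b := M (2 * α) / 2 + 1 / 2
  coercive v := by
    obtain ⟨u, rfl⟩ := sobolevEquiv.surjective v
    have h1 := deltaForm_quad α T (sobolevEquiv.symm (sobolevEquiv u))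
    refine le_trans ?_ (add_le_add_left h1.ge _)
    have h2 := hT.norm_sq_le h hM (by positivity : 0 < 2 * α) u
    change _ ≤ _ + _ * ‖((sobolevEquiv.symm (sobolevEquiv u) : H1) : L2)‖ ^ 2
    rw [LinearEquiv.symm_apply_apply, norm_sobolevEquiv_sq]
    linarith

/-! ### A trace inequality for measures satisfying a Gaussian Schur bound -/

/-- The character `e^{2πi⟨x, ξ⟩}`. -/
def planeChar (x ξ : Plane) : ℂ := Complex.exp (((2 * Real.pi * inner ℝ x ξ : ℝ) : ℂ) * Complex.I)

theorem norm_planeChar (x ξ : Plane) : ‖planeChar x ξ‖ = 1 := Complex.norm_exp_ofReal_mul_I _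

theorem Continuous.planeChar {X : Type*} [TopologicalSpace X] {g h : X → Plane}
    (hg : Continuous g) (hh : Continuous h) : Continuous fun x => planeChar (g x) (h x) := by
  have h1 : Continuous fun x => inner ℝ (g x) (h x) := hg.inner hh
  unfold Leaky.planeChar
  fun_prop

theorem planeChar_mul_conj (x y ξ : Plane) :
    planeChar x ξ * conj (planeChar y ξ) = planeChar (x - y) ξ := by
  unfold planeChar
  rw [← Complex.exp_conj, ← Complex.exp_add, map_mul, Complex.conj_ofReal, Complex.conj_I,
    inner_sub_left]
  congr 1
  push_cast
  ring

theorem integral_planeChar_mul_gaussian {b : ℝ} (hb : 0 < b) (w : Plane) :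
    ∫ ξ, planeChar w ξ * Complex.exp (-(b : ℂ) * ‖ξ‖ ^ 2)
      = ((Real.pi / b * Real.exp (-(Real.pi ^ 2 / b) * ‖w‖ ^ 2) : ℝ) : ℂ) := by
  have h := GaussianFourier.integral_cexp_neg_mul_sq_norm_add (V := Plane) (b := (b : ℂ))
    (by simpa using hb) (2 * Real.pi * Complex.I) w
  have h2 : ∀ ξ, planeChar w ξ * Complex.exp (-(b : ℂ) * ‖ξ‖ ^ 2)
      = Complex.exp (-(b : ℂ) * ‖ξ‖ ^ 2 + 2 * Real.pi * Complex.I * (inner ℝ w ξ : ℝ)) := by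
    intro ξ
    rw [planeChar, ← Complex.exp_add]
    congr 1
    push_cast
    ring
  simp_rw [h2]
  rw [h, finrank_euclideanSpace_fin]
  have h3 : (((2 : ℕ) : ℂ) / 2) = 1 := by norm_num
  rw [h3, Complex.cpow_one]
  push_cast
  congr 2
  have : (b : ℂ) ≠ 0 := by exact_mod_cast hb.ne'
  field_simp
  rw [Complex.I_sq]; ring

variable {ν : Measure Plane} [SFinite ν]

/-- The Fourier transform of the complex measure `f ν`. -/
def measureFourier (ν : Measure Plane) (f : Plane → ℂ) (ξ : Plane) : ℂ :=
  ∫ x, f x * planeChar x ξ ∂ν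

theorem stronglyMeasurable_measureFourier {f : Plane → ℂ} (hf : Continuous f) :
    StronglyMeasurable (measureFourier ν f) := by
  have h : Continuous fun p : Plane × Plane => f p.2 * planeChar p.2 p.1 :=
    (hf.comp continuous_snd).mul (Continuous.planeChar continuous_snd continuous_fst)
  exact h.stronglyMeasurable.integral_prod_right

theorem integrable_gaussian {b : ℝ} (hb : 0 < b) :
    Integrable fun ξ : Plane => Complex.exp (-(b : ℂ) * ‖ξ‖ ^ 2) := by
  simpa using GaussianFourier.integrable_cexp_neg_mul_sq_norm_add (V := Plane) (b := (b : ℂ))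
    (by simpa using hb) 0 0

/-- The integrand in `∫ |F(ξ)|² exp (-b |ξ|²) dξ`, for `F` the Fourier transform of `f ν`. -/
def gaussianIntegrand (f : Plane → ℂ) (b : ℝ) (ξ : Plane) (p : Plane × Plane) : ℂ :=
  (f p.1 * conj (f p.2)) * (planeChar (p.1 - p.2) ξ * Complex.exp (-(b : ℂ) * ‖ξ‖ ^ 2))

theorem continuous_gaussianIntegrand {f : Plane → ℂ} (hf : Continuous f) (b : ℝ) :
    Continuous fun q : Plane × (Plane × Plane) => gaussianIntegrand f b q.1 q.2 := by
  have h1 : Continuous fun q : Plane × (Plane × Plane) => f q.2.1 :=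
    hf.comp (continuous_fst.comp continuous_snd)
  have h2 : Continuous fun q : Plane × (Plane × Plane) => conj (f q.2.2) :=
    Complex.continuous_conj.comp (hf.comp (continuous_snd.comp continuous_snd))
  have h3 : Continuous fun q : Plane × (Plane × Plane) => planeChar (q.2.1 - q.2.2) q.1 := by
    have h5 : Continuous fun q : Plane × (Plane × Plane) => q.2.1 - q.2.2 := by fun_prop
    exact Continuous.planeChar h5 continuous_fst
  have h4 : Continuous fun ξ : Plane => Complex.exp (-(b : ℂ) * ‖ξ‖ ^ 2) := by fun_prop
  exact (h1.mul h2).mul (h3.mul (h4.comp continuous_fst))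

omit [SFinite ν] in
theorem integrable_gaussianIntegrand {f : Plane → ℂ} (hf : Continuous f)
    (hfi : Integrable f ν) {b : ℝ} (hb : 0 < b) :
    Integrable (fun q : Plane × (Plane × Plane) => gaussianIntegrand f b q.1 q.2)
      (volume.prod (ν.prod ν)) := by
  have hconj : Integrable (fun x => conj (f x)) ν := by
    refine hfi.congr' (Complex.continuous_conj.comp hf).aestronglyMeasurable
      (ae_of_all _ fun x => ?_)
    simp
  refine ((integrable_gaussian hb).mul_prod (hfi.mul_prod hconj)).congr'
    (continuous_gaussianIntegrand hf b).aestronglyMeasurable (ae_of_all _ fun q => ?_)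
  simp only [gaussianIntegrand, norm_mul, norm_planeChar]
  ring

theorem integral_gaussianIntegrand_left (f : Plane → ℂ) (b : ℝ) (ξ : Plane) :
    ∫ p, gaussianIntegrand f b ξ p ∂(ν.prod ν)
      = ((‖measureFourier ν f ξ‖ ^ 2 * Real.exp (-b * ‖ξ‖ ^ 2) : ℝ) : ℂ) := by
  have h1 : ∀ p : Plane × Plane, gaussianIntegrand f b ξ p = ((f p.1 * planeChar p.1 ξ) *
      conj (f p.2 * planeChar p.2 ξ)) * Complex.exp (-(b : ℂ) * ‖ξ‖ ^ 2) := by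
    intro p
    rw [gaussianIntegrand, map_mul, ← planeChar_mul_conj]
    ring
  simp_rw [h1]
  rw [integral_mul_const, integral_prod_mul (f := fun x => f x * planeChar x ξ)
    (g := fun x => conj (f x * planeChar x ξ)), integral_conj]
  change measureFourier ν f ξ * conj (measureFourier ν f ξ) * _ = _
  rw [Complex.mul_conj, Complex.normSq_eq_norm_sq]
  push_cast
  rfl

theorem enorm_integral_gaussianIntegrand (f : Plane → ℂ) {b : ℝ} (hb : 0 < b) (p : Plane × Plane) :
    ‖∫ ξ, gaussianIntegrand f b ξ p‖ₑ = ENNReal.ofReal (Real.pi / b) * (‖f p.1‖ₑ * ‖f p.2‖ₑ *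
        ENNReal.ofReal (Real.exp (-(Real.pi ^ 2 / b) * ‖p.1 - p.2‖ ^ 2))) := by
  have hpi := Real.pi_pos
  simp only [gaussianIntegrand]
  rw [integral_const_mul, integral_planeChar_mul_gaussian hb, enorm_mul, enorm_mul,
    RCLike.enorm_conj, ← ofReal_norm (Complex.ofReal _), Complex.norm_real,
    Real.norm_of_nonneg (by positivity), ENNReal.ofReal_mul (by positivity)]
  ring

/-- Expand `|F(ξ)|²` as a double integral over `ν × ν` and integrate in `ξ` first: the Gaussian
weight becomes a Gaussian kernel in `x - y`. The inequality comes only from taking absolute values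
of `f`. -/
theorem lintegral_measureFourier_gaussian_le {f : Plane → ℂ} (hf : Continuous f)
    (hfi : Integrable f ν) {b : ℝ} (hb : 0 < b) :
    ∫⁻ ξ, ‖measureFourier ν f ξ‖ₑ ^ 2 * ENNReal.ofReal (Real.exp (-b * ‖ξ‖ ^ 2)) ≤
      ENNReal.ofReal (Real.pi / b) * ∫⁻ x, ∫⁻ y, ‖f x‖ₑ * ‖f y‖ₑ *
        ENNReal.ofReal (Real.exp (-(Real.pi ^ 2 / b) * ‖x - y‖ ^ 2)) ∂ν ∂ν := by
  have hHi := integrable_gaussianIntegrand hf hfi hb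
  have hleft : Integrable fun ξ => ‖measureFourier ν f ξ‖ ^ 2 * Real.exp (-b * ‖ξ‖ ^ 2) := by
    have := hHi.integral_prod_left
    simp_rw [integral_gaussianIntegrand_left] at this
    simpa only [RCLike.re_to_complex, Complex.ofReal_re] using this.re
  have hlhs : ∫⁻ ξ, ‖measureFourier ν f ξ‖ₑ ^ 2 * ENNReal.ofReal (Real.exp (-b * ‖ξ‖ ^ 2))
      = ‖∫ ξ, ∫ p, gaussianIntegrand f b ξ p ∂(ν.prod ν)‖ₑ := by
    simp_rw [integral_gaussianIntegrand_left]
    rw [integral_complex_ofReal, ← ofReal_norm, Complex.norm_real, Real.norm_of_nonneg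
      (integral_nonneg fun ξ => by positivity), ofReal_integral_eq_lintegral_ofReal hleft
      (ae_of_all _ fun ξ => by positivity)]
    refine lintegral_congr fun ξ => ?_
    rw [ENNReal.ofReal_mul (by positivity), ENNReal.ofReal_pow (norm_nonneg _), ofReal_norm]
  have hmeas : Measurable fun p : Plane × Plane => ‖f p.1‖ₑ * ‖f p.2‖ₑ *
      ENNReal.ofReal (Real.exp (-(Real.pi ^ 2 / b) * ‖p.1 - p.2‖ ^ 2)) := by
    have h1 : Measurable fun x => ‖f x‖ₑ := hf.enorm.measurable
    refine ((h1.comp measurable_fst).mul (h1.comp measurable_snd)).mul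
      (ENNReal.measurable_ofReal.comp (Continuous.measurable ?_))
    fun_prop
  rw [hlhs, integral_integral_swap hHi]
  refine (enorm_integral_le_lintegral_enorm _).trans ?_
  simp_rw [enorm_integral_gaussianIntegrand f hb]
  rw [lintegral_const_mul _ hmeas, lintegral_prod _ hmeas.aemeasurable]

theorem _root_.ENNReal.two_mul_le_add_sq (a b : ENNReal) : 2 * a * b ≤ a ^ 2 + b ^ 2 := by
  rcases le_total a b with h | h <;> obtain ⟨d, rfl⟩ := exists_add_of_le h
  · exact le_of_le_of_eq le_self_add (by ring : 2 * a * (a + d) + d ^ 2 = _)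
  · exact le_of_le_of_eq le_self_add (by ring : 2 * (b + d) * b + d ^ 2 = _)

/-- Schur test: bound `2 a(x) a(y)` by `a(x)² + a(y)²`; by symmetry of the kernel both terms
contribute the same. -/
theorem lintegral_lintegral_mul_le_of_schur {X : Type*} [MeasurableSpace X] {μ : Measure X}
    [SFinite μ] {a : X → ENNReal} {k : X → X → ENNReal} (ha : Measurable a)
    (hk : Measurable (Function.uncurry k)) (hsymm : ∀ x y, k x y = k y x) {S : ENNReal}
    (hS : ∀ᵐ x ∂μ, ∫⁻ y, k x y ∂μ ≤ S) :
    ∫⁻ x, ∫⁻ y, a x * a y * k x y ∂μ ∂μ ≤ S * ∫⁻ x, a x ^ 2 ∂μ := by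
  have hk1 : ∀ x, Measurable (k x) := fun x => hk.of_uncurry_left
  have h1 : ∫⁻ x, ∫⁻ y, a x ^ 2 * k x y ∂μ ∂μ ≤ S * ∫⁻ x, a x ^ 2 ∂μ := by
    rw [← lintegral_const_mul _ (by fun_prop)]
    refine lintegral_mono_ae ?_
    filter_upwards [hS] with x hx
    rw [lintegral_const_mul _ (hk1 x), mul_comm]
    gcongr
  have h2 : ∫⁻ x, ∫⁻ y, a y ^ 2 * k x y ∂μ ∂μ = ∫⁻ x, ∫⁻ y, a x ^ 2 * k x y ∂μ ∂μ := by
    rw [lintegral_lintegral_swap]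
    · simp_rw [fun x y => hsymm y x]
    · refine Measurable.aemeasurable ?_
      exact ((ha.comp measurable_snd).pow_const 2).mul hk
  have h3 : 2 * ∫⁻ x, ∫⁻ y, a x * a y * k x y ∂μ ∂μ ≤ 2 * (S * ∫⁻ x, a x ^ 2 ∂μ) := by
    calc 2 * ∫⁻ x, ∫⁻ y, a x * a y * k x y ∂μ ∂μ
        = ∫⁻ x, ∫⁻ y, 2 * a x * a y * k x y ∂μ ∂μ := by
          rw [← lintegral_const_mul' _ _ ENNReal.ofNat_ne_top]
          refine lintegral_congr fun x => ?_
          rw [← lintegral_const_mul' _ _ ENNReal.ofNat_ne_top]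
          refine lintegral_congr fun y => ?_
          ring
      _ ≤ ∫⁻ x, ∫⁻ y, (a x ^ 2 * k x y + a y ^ 2 * k x y) ∂μ ∂μ := by
          refine lintegral_mono fun x => lintegral_mono fun y => ?_
          rw [← add_mul]
          gcongr
          exact ENNReal.two_mul_le_add_sq _ _
      _ = ∫⁻ x, ∫⁻ y, a x ^ 2 * k x y ∂μ ∂μ + ∫⁻ x, ∫⁻ y, a y ^ 2 * k x y ∂μ ∂μ := by
          rw [← lintegral_add_left]
          · refine lintegral_congr fun x => ?_
            rw [lintegral_add_left ((hk1 x).const_mul _)]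
          · refine Measurable.lintegral_prod_right' (f := fun p : X × X => a p.1 ^ 2 * k p.1 p.2) ?_
            exact ((ha.comp measurable_fst).pow_const 2).mul hk
      _ ≤ 2 * (S * ∫⁻ x, a x ^ 2 ∂μ) := by
          rw [h2, two_mul]; gcongr
  exact (ENNReal.mul_le_mul_iff_right two_ne_zero ENNReal.ofNat_ne_top).mp h3

theorem lintegral_Ioi_rpow_mul_exp {a r : ℝ} (ha : 0 < a) (hr : 0 < r) :
    ∫⁻ t in Ioi (0 : ℝ), ENNReal.ofReal (t ^ (a - 1) * Real.exp (-(r * t)))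
      = ENNReal.ofReal ((1 / r) ^ a * Real.Gamma a) := by
  have h := Real.integral_rpow_mul_exp_neg_mul_Ioi ha hr
  have hpos : 0 < (1 / r) ^ a * Real.Gamma a := mul_pos (by positivity) (Real.Gamma_pos_of_pos ha)
  rw [← h]
  refine (ofReal_integral_eq_lintegral_ofReal ?_ ?_).symm
  -- A non-integrable function would have integral `0` by convention, whereas the Gamma integral is
  -- positive.
  · refine not_imp_comm.mp integral_undef ?_
    rw [h]; exact hpos.ne'
  · filter_upwards [ae_restrict_mem measurableSet_Ioi] with t ht
    have : 0 < t := ht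
    positivity

theorem lintegral_Ioi_exp {r : ℝ} (hr : 0 < r) :
    ∫⁻ t in Ioi (0 : ℝ), ENNReal.ofReal (Real.exp (-(r * t))) = ENNReal.ofReal (1 / r) := by
  have h := lintegral_Ioi_rpow_mul_exp one_pos hr
  rw [Real.Gamma_one, mul_one, Real.rpow_one] at h
  simpa using h

/-! ### From the heat kernel to the resolvent kernel -/

/-- The Schur bound for Gaussian kernels, as satisfied by the arc length measure of a straight
line when `c = 1`. -/
def GaussianSchur (ν : Measure Plane) (c : ℝ) : Prop :=
  ∀ t : ℝ, 0 < t → ∀ᵐ x ∂ν,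
    ∫⁻ y, ENNReal.ofReal (Real.exp (-(1 / (4 * t)) * ‖x - y‖ ^ 2)) ∂ν
      ≤ ENNReal.ofReal (√(4 * Real.pi * t) / c)

/-- The weight is the symbol of the heat semigroup at time `t`, whose kernel is `(4πt)⁻¹ exp(-|x -
y|² / 4t)`. Multiplying by the Schur constant `√(4πt) / c` gives the stated factor. -/
theorem GaussianSchur.lintegral_measureFourier_le {c : ℝ} (hν : GaussianSchur ν c) (hc : 0 < c)
    {f : Plane → ℂ} (hf : Continuous f) (hfi : Integrable f ν) {t : ℝ} (ht : 0 < t) :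
    ∫⁻ ξ, ‖measureFourier ν f ξ‖ₑ ^ 2 *
        ENNReal.ofReal (Real.exp (-(4 * Real.pi ^ 2 * t) * ‖ξ‖ ^ 2)) ≤
      ENNReal.ofReal (1 / (√(4 * Real.pi * t) * c)) * ∫⁻ x, ‖f x‖ₑ ^ 2 ∂ν := by
  have hpi := Real.pi_pos
  refine (lintegral_measureFourier_gaussian_le hf hfi (by positivity)).trans ?_
  have h1 : Real.pi ^ 2 / (4 * Real.pi ^ 2 * t) = 1 / (4 * t) := by field_simp
  rw [h1]
  have h2 := lintegral_lintegral_mul_le_of_schur (μ := ν) (a := fun x => ‖f x‖ₑ)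
    (k := fun x y => ENNReal.ofReal (Real.exp (-(1 / (4 * t)) * ‖x - y‖ ^ 2)))
    (S := ENNReal.ofReal (√(4 * Real.pi * t) / c)) hf.enorm.measurable
    (by unfold Function.uncurry; fun_prop) (fun x y => by rw [norm_sub_rev])
    (hν t ht)
  refine (mul_le_mul_right h2 _).trans_eq ?_
  rw [← mul_assoc, ← ENNReal.ofReal_mul (by positivity)]
  congr 2
  have h3 : Real.pi / (4 * Real.pi ^ 2 * t) = 1 / (√(4 * Real.pi * t) * √(4 * Real.pi * t)) := by
    rw [Real.mul_self_sqrt (by positivity)]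
    field_simp
  have h4 : √(4 * Real.pi * t) ≠ 0 := (Real.sqrt_pos.mpr (by positivity)).ne'
  rw [h3]
  generalize √(4 * Real.pi * t) = s at h4
  field_simp

/-- The resolvent symbol is the Laplace transform in `t` of the heat symbol. What remains is `∫
t^(-1/2) exp(-κ² t) dt = √π / κ`, and `(√π / κ) / (√(4π) c) = 1 / (2κc)`. -/
theorem GaussianSchur.lintegral_measureFourier_div_le {c κ : ℝ} (hν : GaussianSchur ν c)
    (hc : 0 < c) (hκ : 0 < κ) {f : Plane → ℂ} (hf : Continuous f) (hfi : Integrable f ν) :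
    ∫⁻ ξ, ‖measureFourier ν f ξ‖ₑ ^ 2 *
        ENNReal.ofReal (1 / (κ ^ 2 + 4 * Real.pi ^ 2 * ‖ξ‖ ^ 2)) ≤
      ENNReal.ofReal (1 / (2 * κ * c)) * ∫⁻ x, ‖f x‖ₑ ^ 2 ∂ν := by
  have hpi := Real.pi_pos
  have hmeas : Measurable (measureFourier ν f) := (stronglyMeasurable_measureFourier hf).measurable
  calc ∫⁻ ξ, ‖measureFourier ν f ξ‖ₑ ^ 2 *
        ENNReal.ofReal (1 / (κ ^ 2 + 4 * Real.pi ^ 2 * ‖ξ‖ ^ 2))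
      = ∫⁻ ξ, ∫⁻ t in Ioi (0 : ℝ), ENNReal.ofReal (Real.exp (-(κ ^ 2 * t))) *
          (‖measureFourier ν f ξ‖ₑ ^ 2 *
            ENNReal.ofReal (Real.exp (-(4 * Real.pi ^ 2 * t) * ‖ξ‖ ^ 2))) := by
        refine lintegral_congr fun ξ => ?_
        rw [← lintegral_Ioi_exp (by positivity), ← lintegral_const_mul _ (by fun_prop)]
        refine lintegral_congr fun t => ?_
        rw [mul_left_comm, ← ENNReal.ofReal_mul (by positivity), ← Real.exp_add]
        congr 3
        ring
    _ = ∫⁻ t in Ioi (0 : ℝ), ∫⁻ ξ, ENNReal.ofReal (Real.exp (-(κ ^ 2 * t))) *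
          (‖measureFourier ν f ξ‖ₑ ^ 2 *
            ENNReal.ofReal (Real.exp (-(4 * Real.pi ^ 2 * t) * ‖ξ‖ ^ 2))) := by
        refine lintegral_lintegral_swap (Measurable.aemeasurable ?_)
        simp only [Function.uncurry_def]
        fun_prop
    _ ≤ ∫⁻ t in Ioi (0 : ℝ), ENNReal.ofReal (1 / (√(4 * Real.pi) * c)) *
          (∫⁻ x, ‖f x‖ₑ ^ 2 ∂ν) *
            ENNReal.ofReal (t ^ ((1 / 2 : ℝ) - 1) * Real.exp (-(κ ^ 2 * t))) := by
        refine setLIntegral_mono (by fun_prop) fun t ht => ?_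
        have ht' : 0 < t := ht
        rw [lintegral_const_mul _ (by fun_prop)]
        refine (mul_le_mul_right (hν.lintegral_measureFourier_le hc hf hfi ht') _).trans_eq ?_
        have h1 : t ^ ((1 / 2 : ℝ) - 1) = 1 / √t := by
          rw [Real.sqrt_eq_rpow, show (1 / 2 : ℝ) - 1 = -(1 / 2) by norm_num, Real.rpow_neg ht'.le,
            one_div (t ^ (1 / 2 : ℝ))]
        rw [h1, Real.sqrt_mul (by positivity) t]
        have h2 : 1 / (√(4 * Real.pi) * √t * c)
          = 1 / (√(4 * Real.pi) * c) * (1 / √t) := by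
            rw [one_div_mul_one_div]; congr 1; ring
        rw [h2, ENNReal.ofReal_mul (by positivity), ENNReal.ofReal_mul (by positivity)]
        ring
    _ = ENNReal.ofReal (1 / (2 * κ * c)) * ∫⁻ x, ‖f x‖ₑ ^ 2 ∂ν := by
        rw [lintegral_const_mul _ (by fun_prop), lintegral_Ioi_rpow_mul_exp (by norm_num)
          (by positivity), mul_right_comm, ← ENNReal.ofReal_mul (by positivity)]
        congr 2
        rw [Real.Gamma_one_half_eq, ← Real.sqrt_eq_rpow, Real.sqrt_mul (by norm_num),
          Real.sqrt_div zero_le_one, Real.sqrt_sq hκ.le, Real.sqrt_one,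
          show (4 : ℝ) = 2 ^ 2 by norm_num, Real.sqrt_sq (by norm_num)]
        have : √Real.pi ≠ 0 := (Real.sqrt_pos.mpr hpi).ne'
        field_simp

/-! ### Duality: from the resolvent bound to the trace inequality -/

theorem schwartz_eq_integral_planeChar (ψ : 𝓢(Plane, ℂ)) (x : Plane) :
    ψ x = ∫ ξ, (𝓕 ψ : 𝓢(Plane, ℂ)) ξ * planeChar x ξ := by
  have h1 : ψ x = (𝓕⁻ (𝓕 ψ : 𝓢(Plane, ℂ)) : 𝓢(Plane, ℂ)) x := by
    rw [FourierTransform.fourierInv_fourier_eq]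
  rw [h1, SchwartzMap.fourierInv_coe, Real.fourierInv_eq']
  refine integral_congr_ae (ae_of_all _ fun ξ => ?_)
  simp only [planeChar, smul_eq_mul, real_inner_comm x ξ]
  ring

theorem lintegral_enorm_sq_schwartz (φ : 𝓢(Plane, ℂ)) :
    ∫⁻ x, ‖φ x‖ₑ ^ 2 = ENNReal.ofReal (‖φ.toLp 2 (volume : Measure Plane)‖ ^ 2) := by
  rw [← eLpNorm_two_sq, ENNReal.ofReal_pow (norm_nonneg _), SchwartzMap.norm_toLp,
    ENNReal.ofReal_toReal (φ.memLp 2 volume).eLpNorm_ne_top]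

theorem lintegral_enorm_sq_fourier (φ : 𝓢(Plane, ℂ)) :
    ∫⁻ ξ, ‖(𝓕 φ : 𝓢(Plane, ℂ)) ξ‖ₑ ^ 2
      = ENNReal.ofReal (‖φ.toLp 2 (volume : Measure Plane)‖ ^ 2) := by
  rw [lintegral_enorm_sq_schwartz, SchwartzMap.norm_fourier_toL2_eq]

/-- The energy `‖∇ψ‖² + κ² ‖ψ‖²` in Fourier space. -/
theorem lintegral_weight_fourier (ψ : 𝓢(Plane, ℂ)) (κ : ℝ) :
    ∫⁻ ξ, ENNReal.ofReal (κ ^ 2 + 4 * Real.pi ^ 2 * ‖ξ‖ ^ 2) * ‖(𝓕 ψ : 𝓢(Plane, ℂ)) ξ‖ₑ ^ 2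
      = ENNReal.ofReal (gradNormSq (schwartzToH1 ψ)
          + κ ^ 2 * ‖ψ.toLp 2 (volume : Measure Plane)‖ ^ 2) := by
  have hm : ∀ f : 𝓢(Plane, ℂ), Measurable fun ξ => ‖f ξ‖ₑ ^ 2 := fun f => by
    have := f.continuous
    fun_prop
  have hpt : ∀ ξ, ENNReal.ofReal (κ ^ 2 + 4 * Real.pi ^ 2 * ‖ξ‖ ^ 2)
      * ‖(𝓕 ψ : 𝓢(Plane, ℂ)) ξ‖ₑ ^ 2
      = ‖(𝓕 (∂_{e 0} ψ) : 𝓢(Plane, ℂ)) ξ‖ₑ ^ 2 + ‖(𝓕 (∂_{e 1} ψ) : 𝓢(Plane, ℂ)) ξ‖ₑ ^ 2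
        + ENNReal.ofReal (κ ^ 2) * ‖(𝓕 ψ : 𝓢(Plane, ℂ)) ξ‖ₑ ^ 2 := by
    intro ξ
    simp only [← ofReal_norm, ← ENNReal.ofReal_pow (norm_nonneg _)]
    rw [← ENNReal.ofReal_mul (by positivity), ← ENNReal.ofReal_mul (by positivity),
      ← ENNReal.ofReal_add (by positivity) (by positivity),
      ← ENNReal.ofReal_add (by positivity) (by positivity)]
    congr 1
    simp only [fourier_lineDeriv_apply, norm_mul, Complex.norm_I, Complex.norm_real, mul_pow,
      Complex.norm_two, Real.norm_eq_abs, sq_abs]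
    rw [EuclideanSpace.real_norm_sq_eq, Fin.sum_univ_two]
    ring
  simp_rw [hpt]
  rw [lintegral_add_right _ ((hm _).const_mul _), lintegral_add_left (hm _),
    lintegral_const_mul _ (hm _), lintegral_enorm_sq_fourier, lintegral_enorm_sq_fourier,
    lintegral_enorm_sq_fourier, ← ENNReal.ofReal_mul (by positivity),
    ← ENNReal.ofReal_add (by positivity) (by positivity),
    ← ENNReal.ofReal_add (by positivity) (by positivity), gradNormSq, Fin.sum_univ_two,
    partialDeriv_schwartz, partialDeriv_schwartz]

variable {ν : Measure Plane} [IsFiniteMeasure ν]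

theorem integrable_schwartz (ψ : 𝓢(Plane, ℂ)) : Integrable ψ ν := by
  obtain ⟨C, hC⟩ := ψ.decay 0 0
  refine Integrable.of_bound ψ.continuous.aestronglyMeasurable C (ae_of_all _ fun x => ?_)
  simpa using hC.2 x

/-- Parseval's identity for the measure `|ψ|² ν`. -/
theorem integral_conj_mul_eq (ψ : 𝓢(Plane, ℂ)) :
    ∫ x, conj (ψ x) * ψ x ∂ν
      = ∫ ξ, (𝓕 ψ : 𝓢(Plane, ℂ)) ξ * measureFourier ν (fun x => conj (ψ x)) ξ := by
  have hconj : Continuous fun x => conj (ψ x) := Complex.continuous_conj.comp ψ.continuous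
  have hconji : Integrable (fun x => conj (ψ x)) ν :=
    (integrable_schwartz (ν := ν) ψ).congr' hconj.aestronglyMeasurable
      (ae_of_all _ fun x => by simp)
  have hint : Integrable (fun p : Plane × Plane =>
      conj (ψ p.1) * ((𝓕 ψ : 𝓢(Plane, ℂ)) p.2 * planeChar p.1 p.2)) (ν.prod volume) := by
    refine (hconji.mul_prod (𝓕 ψ : 𝓢(Plane, ℂ)).integrable).congr' ?_ (ae_of_all _ fun p => ?_)
    · exact ((hconj.comp continuous_fst).mul (((𝓕 ψ : 𝓢(Plane, ℂ)).continuous.comp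
        continuous_snd).mul (Continuous.planeChar continuous_fst
          continuous_snd))).aestronglyMeasurable
    · simp only [norm_mul, norm_planeChar, mul_one]
  calc ∫ x, conj (ψ x) * ψ x ∂ν
      = ∫ x, ∫ ξ, conj (ψ x) * ((𝓕 ψ : 𝓢(Plane, ℂ)) ξ * planeChar x ξ) ∂volume ∂ν := by
        refine integral_congr_ae (ae_of_all _ fun x => ?_)
        change _ = ∫ ξ, conj (ψ x) * ((𝓕 ψ : 𝓢(Plane, ℂ)) ξ * planeChar x ξ)
        rw [integral_const_mul, ← schwartz_eq_integral_planeChar]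
    _ = ∫ ξ, ∫ x, conj (ψ x) * ((𝓕 ψ : 𝓢(Plane, ℂ)) ξ * planeChar x ξ) ∂ν :=
        integral_integral_swap hint
    _ = _ := by
        refine integral_congr_ae (ae_of_all _ fun ξ => ?_)
        change _ = (𝓕 ψ : 𝓢(Plane, ℂ)) ξ * ∫ x, conj (ψ x) * planeChar x ξ ∂ν
        rw [← integral_const_mul]
        refine integral_congr_ae (ae_of_all _ fun x => ?_)
        change _ * (_ * _) = _ * (_ * _)
        ring

theorem GaussianSchur.lintegral_enorm_sq_le {c κ : ℝ} (hν : GaussianSchur ν c) (hc : 0 < c)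
    (hκ : 0 < κ) (ψ : 𝓢(Plane, ℂ)) :
    ∫⁻ x, ‖ψ x‖ₑ ^ 2 ∂ν ≤ ENNReal.ofReal (1 / (2 * κ * c) * (gradNormSq (schwartzToH1 ψ)
          + κ ^ 2 * ‖ψ.toLp 2 (volume : Measure Plane)‖ ^ 2)) := by
  have hpi := Real.pi_pos
  set K := 1 / (2 * κ * c) with hK
  have hK0 : 0 < K := by positivity
  set P := gradNormSq (schwartzToH1 ψ) + κ ^ 2 * ‖ψ.toLp 2 (volume : Measure Plane)‖ ^ 2 with hP
  have hP0 : 0 ≤ P := add_nonneg (gradNormSq_nonneg _) (by positivity)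
  have hconj : Continuous fun x => conj (ψ x) := Complex.continuous_conj.comp ψ.continuous
  have hconji : Integrable (fun x => conj (ψ x)) ν :=
    (integrable_schwartz (ν := ν) ψ).congr' hconj.aestronglyMeasurable
      (ae_of_all _ fun x => by simp)
  set G := measureFourier ν (fun x => conj (ψ x)) with hG
  have hGm : Measurable G := (stronglyMeasurable_measureFourier hconj).measurable
  have hsq : Integrable (fun x => ‖ψ x‖ ^ 2) ν := by
    obtain ⟨C, hC⟩ := ψ.decay 0 0
    refine Integrable.of_bound (by have := ψ.continuous; fun_prop) (C ^ 2)
      (ae_of_all _ fun x => ?_)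
    have := hC.2 x
    simp only [pow_zero, one_mul, norm_iteratedFDeriv_zero] at this
    rw [Real.norm_of_nonneg (by positivity)]
    gcongr
  set a := ∫ x, ‖ψ x‖ ^ 2 ∂ν with ha
  have ha0 : 0 ≤ a := integral_nonneg fun x => by positivity
  have hA : ∫⁻ x, ‖ψ x‖ₑ ^ 2 ∂ν = ENNReal.ofReal a := by
    rw [ha, ofReal_integral_eq_lintegral_ofReal hsq (ae_of_all _ fun x => by positivity)]
    refine lintegral_congr fun x => ?_
    rw [ENNReal.ofReal_pow (norm_nonneg _), ofReal_norm]
  have hQ := hν.lintegral_measureFourier_div_le hc hκ hconj hconji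
  simp only [RCLike.enorm_conj] at hQ
  rw [hA, ← hK, ← ENNReal.ofReal_mul hK0.le, ← hG] at hQ
  have hpars : ENNReal.ofReal a ≤ ∫⁻ ξ, ‖(𝓕 ψ : 𝓢(Plane, ℂ)) ξ‖ₑ * ‖G ξ‖ₑ := by
    have h1 := integral_conj_mul_eq (ν := ν) ψ
    have h2 : ∫ x, conj (ψ x) * ψ x ∂ν = ((a : ℝ) : ℂ) := by
      rw [ha, ← integral_complex_ofReal]
      refine integral_congr_ae (ae_of_all _ fun x => ?_)
      simp only [Complex.conj_mul', Complex.ofReal_pow]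
    have h3 : ENNReal.ofReal a = ‖((a : ℝ) : ℂ)‖ₑ := by
      rw [← ofReal_norm, Complex.norm_real, Real.norm_of_nonneg ha0]
    rw [h3, ← h2, h1]
    refine (enorm_integral_le_lintegral_enorm _).trans_eq ?_
    simp_rw [enorm_mul]
    rfl
  -- Weighted arithmetic–geometric mean inequality; the weight `K` is chosen so that the resolvent
  -- bound turns the second term into exactly `a / 2`.
  have hpt : ∀ ξ, ‖(𝓕 ψ : 𝓢(Plane, ℂ)) ξ‖ₑ * ‖G ξ‖ₑ ≤
      ENNReal.ofReal (K / 2) * (ENNReal.ofReal (κ ^ 2 + 4 * Real.pi ^ 2 * ‖ξ‖ ^ 2)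
        * ‖(𝓕 ψ : 𝓢(Plane, ℂ)) ξ‖ₑ ^ 2)
      + ENNReal.ofReal (1 / (2 * K)) * (‖G ξ‖ₑ ^ 2
        * ENNReal.ofReal (1 / (κ ^ 2 + 4 * Real.pi ^ 2 * ‖ξ‖ ^ 2))) := by
    intro ξ
    simp only [← ofReal_norm, ← ENNReal.ofReal_pow (norm_nonneg _)]
    have hw : 0 < κ ^ 2 + 4 * Real.pi ^ 2 * ‖ξ‖ ^ 2 := by positivity
    generalize κ ^ 2 + 4 * Real.pi ^ 2 * ‖ξ‖ ^ 2 = w at hw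
    rw [← ENNReal.ofReal_mul (by positivity), ← ENNReal.ofReal_mul (by positivity),
      ← ENNReal.ofReal_mul (by positivity), ← ENNReal.ofReal_mul (by positivity),
      ← ENNReal.ofReal_mul (by positivity), ← ENNReal.ofReal_add (by positivity) (by positivity)]
    refine ENNReal.ofReal_le_ofReal ?_
    generalize ‖(𝓕 ψ : 𝓢(Plane, ℂ)) ξ‖ = x
    generalize ‖G ξ‖ = y
    have h1 : K / 2 * (w * x ^ 2) + 1 / (2 * K) * (y ^ 2 * (1 / w)) - x * y
        = (K * w * x - y) ^ 2 / (2 * K * w) := by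
      field_simp
      ring
    have h2 : 0 ≤ (K * w * x - y) ^ 2 / (2 * K * w) := by positivity
    linarith
  have hψm : Measurable fun ξ => (𝓕 ψ : 𝓢(Plane, ℂ)) ξ := (𝓕 ψ : 𝓢(Plane, ℂ)).continuous.measurable
  have hle := hpars.trans (lintegral_mono hpt)
  rw [lintegral_add_left (by fun_prop), lintegral_const_mul _ (by fun_prop),
    lintegral_const_mul _ (by fun_prop), lintegral_weight_fourier, ← hP] at hle
  have hle2 := hle.trans (add_le_add_right (mul_le_mul_right hQ _) _)
  rw [← ENNReal.ofReal_mul (by positivity), ← ENNReal.ofReal_mul (by positivity),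
    ← ENNReal.ofReal_add (by positivity) (by positivity),
    ENNReal.ofReal_le_ofReal_iff (by positivity)] at hle2
  rw [hA]
  refine ENNReal.ofReal_le_ofReal ?_
  -- The term `a / 2` is absorbed on the left, which is legitimate because `a` is a real number: `ν`
  -- is finite and `ψ` bounded.
  have h1 : 1 / (2 * K) * (K * a) = a / 2 := by field_simp
  rw [h1] at hle2
  linarith

/-! ### Curves -/

/-- Fundamental theorem of calculus off the finitely many break points in `[a, b]`, with unit speed
elsewhere. -/
theorem IsPiecewiseC1.norm_sub_le {γ : ℝ → Plane} {I : Set ℝ} (h : IsPiecewiseC1 γ I)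
    {a b : ℝ} (hab : a ≤ b) (hI : Icc a b ⊆ I) : ‖γ b - γ a‖ ≤ b - a := by
  obtain ⟨hcont, S, hfin, hC1, hspeed⟩ := h
  have hderiv : ∀ x ∈ Ioo a b \ (S ∩ Icc a b), DifferentiableAt ℝ γ x ∧ ‖deriv γ x‖ = 1 := by
    intro x hx
    have hxS : x ∉ S := fun hS => hx.2 ⟨hS, Ioo_subset_Icc_self hx.1⟩
    have hU : Ioo a b \ (S ∩ Icc a b) ∈ 𝓝 x :=
      (isOpen_Ioo.sdiff (hfin a b).isClosed).mem_nhds hx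
    obtain ⟨ε, hε, hεU⟩ := (nhds_basis_Icc_pos x).mem_iff.mp hU
    have hlt : x - ε < x + ε := by linarith
    refine ⟨?_, hspeed x ⟨?_, hxS⟩⟩
    · have h1 := hC1 (x - ε) (x + ε) hlt
        (fun y hy => hI (Ioo_subset_Icc_self (hεU hy).1))
        (Set.disjoint_left.mpr fun y hy hyS => (hεU (Ioo_subset_Icc_self hy)).2
          ⟨hyS, Ioo_subset_Icc_self (hεU (Ioo_subset_Icc_self hy)).1⟩)
      exact (h1.contDiffAt (Icc_mem_nhds (by linarith) (by linarith))).differentiableAt one_ne_zero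
    · exact mem_interior_iff_mem_nhds.mpr
        (mem_of_superset (Ioo_mem_nhds hx.1.1 hx.1.2) (Ioo_subset_Icc_self.trans hI))
  have hae : ∀ᵐ x ∂volume, x ∈ Ioc a b → ‖deriv γ x‖ ≤ 1 := by
    have h1 : ∀ᵐ x ∂(volume : Measure ℝ), x ∉ S ∩ Icc a b :=
      measure_eq_zero_iff_ae_notMem.mp ((hfin a b).measure_zero _)
    have h2 : ∀ᵐ x ∂(volume : Measure ℝ), x ≠ b := by
      simp [ae_iff]
    filter_upwards [h1, h2] with x hx hxb hxab
    exact (hderiv x ⟨⟨hxab.1, lt_of_le_of_ne hxab.2 hxb⟩, hx⟩).2.le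
  have hint : IntervalIntegrable (deriv γ) volume a b := by
    rw [intervalIntegrable_iff_integrableOn_Ioc_of_le hab]
    refine Integrable.of_bound (stronglyMeasurable_deriv γ).aestronglyMeasurable 1 ?_
    exact (ae_restrict_iff' measurableSet_Ioc).mpr hae
  have hFTC := integral_eq_of_hasDerivAt_off_countable_of_le γ (deriv γ) hab
    (hfin a b).countable (hcont.mono hI) (fun x hx => (hderiv x hx).1.hasDerivAt) hint
  rw [← hFTC]
  have := intervalIntegral.norm_integral_le_of_norm_le_const_ae (C := 1) (f := deriv γ)
    (a := a) (b := b) (by rwa [uIoc_of_le hab])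
  rwa [one_mul, abs_of_nonneg (sub_nonneg.mpr hab)] at this

theorem IsPiecewiseC1.lipschitzOnWith {γ : ℝ → Plane} {I : Set ℝ} (h : IsPiecewiseC1 γ I)
    (hI : I.OrdConnected) : LipschitzOnWith 1 γ I := by
  refine LipschitzOnWith.of_dist_le_mul fun s hs t ht => ?_
  rw [NNReal.coe_one, one_mul, dist_eq_norm, Real.dist_eq]
  rcases le_total s t with hst | hst
  · rw [norm_sub_rev, abs_sub_comm, abs_of_nonneg (sub_nonneg.mpr hst)]
    exact h.norm_sub_le hst (hI.out hs ht)
  · rw [abs_of_nonneg (sub_nonneg.mpr hst)]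
    exact h.norm_sub_le hst (hI.out ht hs)

/-- A 1-Lipschitz parametrization does not decrease length. -/
theorem restrict_hausdorffMeasure_le_map {γ : ℝ → Plane} {D : Set ℝ} (hD : MeasurableSet D)
    (hγ : LipschitzOnWith 1 γ D) {A : Set Plane} (hA : A ⊆ γ '' D) :
    lengthMeasure A ≤ (volume.restrict D).map γ := by
  refine Measure.le_iff.mpr fun B hB => ?_
  rw [lengthMeasure, Measure.restrict_apply hB,
    Measure.map_apply_of_aemeasurable (hγ.continuousOn.aemeasurable hD) hB,
    Measure.restrict_apply' hD]
  have h1 : B ∩ A ⊆ γ '' (γ ⁻¹' B ∩ D) := by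
    rintro x ⟨hxB, hxA⟩
    obtain ⟨s, hs, rfl⟩ := hA hxA
    exact ⟨s, ⟨hxB, hs⟩, rfl⟩
  refine (measure_mono h1).trans ?_
  have h2 := (hγ.mono (inter_subset_right (s := γ ⁻¹' B))).hausdorffMeasure_image_le
    (d := 1) zero_le_one
  rw [hausdorffMeasure_real] at h2
  simpa using h2

namespace Curve

theorem measurableSet_dom (Λ : Curve) : MeasurableSet Λ.dom := by
  cases Λ with
  | line γ => exact MeasurableSet.univ
  | loop L γ => exact measurableSet_Icc

theorem ordConnected_dom (Λ : Curve) : Λ.dom.OrdConnected := by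
  cases Λ with
  | line γ => exact ordConnected_univ
  | loop L γ => exact ordConnected_Icc

theorem IsAdmissible.isPiecewiseC1 {Λ : Curve} (h : Λ.IsAdmissible) :
    IsPiecewiseC1 Λ.param Λ.dom := by
  cases Λ with
  | line γ => exact h.1
  | loop L γ => exact h.2.1

theorem arcDist_nonneg {Λ : Curve} {s t : ℝ} (hs : s ∈ Λ.dom) (ht : t ∈ Λ.dom) :
    0 ≤ Λ.arcDist s t := by
  cases Λ with
  | line γ => exact abs_nonneg _
  | loop L γ =>
    refine le_min (abs_nonneg _) (sub_nonneg.mpr (abs_le.mpr ⟨?_, ?_⟩))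
    · linarith [hs.1, ht.2]
    · linarith [hs.2, ht.1]

theorem c_mul_arcDist_le {Λ : Curve} {s t : ℝ} (hs : s ∈ Λ.dom) (ht : t ∈ Λ.dom) :
    Λ.c * Λ.arcDist s t ≤ ‖Λ.param s - Λ.param t‖ := by
  rcases (arcDist_nonneg hs ht).eq_or_lt with h | h
  · rw [← h, mul_zero]; exact norm_nonneg _
  · rw [← le_div_iff₀ h]
    refine csInf_le ⟨0, ?_⟩ ⟨s, hs, t, ht, h, rfl⟩
    rintro _ ⟨s, -, t, -, h, rfl⟩
    exact div_nonneg (norm_nonneg _) h.le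

/-- The arc length measure of the curve, counted with multiplicity. -/
def arcMeasure (Λ : Curve) : Measure Plane := (volume.restrict Λ.dom).map Λ.param

end Curve

/-! ### Gaussian integrals in arc distance -/

theorem lintegral_gaussian {β : ℝ} (hβ : 0 < β) :
    ∫⁻ u : ℝ, ENNReal.ofReal (Real.exp (-β * u ^ 2)) = ENNReal.ofReal √(Real.pi / β) := by
  rw [← integral_gaussian, ofReal_integral_eq_lintegral_ofReal (integrable_exp_neg_mul_sq hβ)
    (ae_of_all _ fun u => (Real.exp_pos _).le)]

theorem intervalIntegral_exp_neg_mul_addCircle_norm_sq {L : ℝ} (hL : 0 < L) (β s : ℝ) :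
    ∫ t in (0 : ℝ)..L, Real.exp (-β * ‖((s - t : ℝ) : AddCircle L)‖ ^ 2)
      = ∫ u in (-(L / 2))..(L / 2), Real.exp (-β * u ^ 2) := by
  have hper : Function.Periodic
      (fun u : ℝ => Real.exp (-β * ‖(u : AddCircle L)‖ ^ 2)) L := fun u => by
    simp only [AddCircle.coe_add_period]
  rw [intervalIntegral.integral_comp_sub_left
    (fun u : ℝ => Real.exp (-β * ‖(u : AddCircle L)‖ ^ 2)) s, sub_zero]
  -- By periodicity the integral moves to the period centred at `0`, where the circle norm is the
  -- absolute value.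
  have h1 := hper.intervalIntegral_add_eq (s - L) (-(L / 2))
  rw [sub_add_cancel, show -(L / 2) + L = L / 2 by ring] at h1
  rw [h1]
  refine intervalIntegral.integral_congr fun u hu => ?_
  rw [uIcc_of_le (by linarith)] at hu
  have h2 : ‖(u : AddCircle L)‖ = |u| := by
    rw [AddCircle.norm_coe_eq_abs_iff L hL.ne', abs_of_pos hL]
    exact abs_le.mpr ⟨by linarith [hu.1], hu.2⟩
  simp only [h2, sq_abs]

theorem addCircle_norm_le (L u : ℝ) : ‖(u : AddCircle L)‖ ≤ |u| :=
  QuotientAddGroup.norm_mk_le_norm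

theorem addCircle_norm_le_min (L u : ℝ) : ‖(u : AddCircle L)‖ ≤ min |u| (L - |u|) ∨ L < |u| := by
  rcases lt_or_ge L |u| with h | h
  · exact Or.inr h
  refine Or.inl (le_min (addCircle_norm_le L u) ?_)
  rcases le_total 0 u with hu | hu
  · rw [abs_of_nonneg hu] at h ⊢
    have h1 : ((u - L : ℝ) : AddCircle L) = u := by simp
    rw [← h1]
    refine (addCircle_norm_le L _).trans_eq ?_
    rw [abs_of_nonpos (by linarith)]; ring
  · rw [abs_of_nonpos hu] at h ⊢
    have h1 : ((u + L : ℝ) : AddCircle L) = u := by simp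
    rw [← h1]
    refine (addCircle_norm_le L _).trans_eq ?_
    rw [abs_of_nonneg (by linarith)]; ring

namespace Curve

/-- On a line this is translation invariance. On a loop the arc distance dominates the norm in `ℝ /
Lℤ`, and the Gaussian of that norm integrates to a Gaussian over `[-L/2, L/2]`, which is less than
over all of `ℝ`. -/
theorem lintegral_arcDist_le {Λ : Curve} (hΛ : Λ.IsAdmissible) {β : ℝ} (hβ : 0 < β) {s : ℝ}
    (hs : s ∈ Λ.dom) :
    ∫⁻ t in Λ.dom, ENNReal.ofReal (Real.exp (-β * Λ.arcDist s t ^ 2))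
      ≤ ENNReal.ofReal √(Real.pi / β) := by
  cases Λ with
  | line γ =>
    change ∫⁻ t in univ, ENNReal.ofReal (Real.exp (-β * |s - t| ^ 2)) ≤ _
    simp_rw [Measure.restrict_univ, sq_abs]
    rw [lintegral_sub_left_eq_self (fun u => ENNReal.ofReal (Real.exp (-β * u ^ 2))),
      lintegral_gaussian hβ]
  | loop L γ =>
    have hL : 0 < L := hΛ.1
    have hcont : Continuous fun t : ℝ => Real.exp (-β * ‖((s - t : ℝ) : AddCircle L)‖ ^ 2) := by
      have : Continuous fun t : ℝ => ((s - t : ℝ) : AddCircle L) :=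
        (AddCircle.continuous_mk' L).comp (by fun_prop)
      fun_prop
    calc ∫⁻ t in Icc 0 L, ENNReal.ofReal (Real.exp (-β * (min |s - t| (L - |s - t|)) ^ 2))
        ≤ ∫⁻ t in Icc 0 L,
            ENNReal.ofReal (Real.exp (-β * ‖((s - t : ℝ) : AddCircle L)‖ ^ 2)) := by
          refine setLIntegral_mono (by fun_prop) fun t ht => ?_
          refine ENNReal.ofReal_le_ofReal (Real.exp_le_exp.mpr ?_)
          have h1 : |s - t| ≤ L :=
            abs_le.mpr ⟨by linarith [hs.1, ht.2], by linarith [hs.2, ht.1]⟩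
          have h2 := (addCircle_norm_le_min L (s - t)).resolve_right (not_lt.mpr h1)
          have h3 := pow_le_pow_left₀ (norm_nonneg _) h2 2
          rw [neg_mul, neg_mul]
          exact neg_le_neg (mul_le_mul_of_nonneg_left h3 hβ.le)
      _ = ENNReal.ofReal (∫ t in (0 : ℝ)..L,
            Real.exp (-β * ‖((s - t : ℝ) : AddCircle L)‖ ^ 2)) := by
          rw [intervalIntegral.integral_of_le hL.le, ← integral_Icc_eq_integral_Ioc,
            ofReal_integral_eq_lintegral_ofReal
              (hcont.continuousOn.integrableOn_compact isCompact_Icc)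
              (ae_of_all _ fun _ => (Real.exp_pos _).le)]
      _ ≤ ENNReal.ofReal √(Real.pi / β) := by
          rw [intervalIntegral_exp_neg_mul_addCircle_norm_sq hL, ← integral_gaussian,
            intervalIntegral.integral_of_le (by linarith)]
          exact ENNReal.ofReal_le_ofReal (setIntegral_le_integral (integrable_exp_neg_mul_sq hβ)
            (ae_of_all _ fun _ => (Real.exp_pos _).le))

theorem aemeasurable_param {Λ : Curve} (hΛ : Λ.IsAdmissible) :
    AEMeasurable Λ.param (volume.restrict Λ.dom) :=
  hΛ.isPiecewiseC1.1.aemeasurable Λ.measurableSet_dom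

/-- The chord–arc inequality replaces `|x - y|` by `c` times the arc distance, so the Gaussian
parameter becomes `β = c² / (4t)` and `√(π / β) = √(4πt) / c`. -/
theorem gaussianSchur_arcMeasure {Λ : Curve} (hΛ : Λ.IsAdmissible) (hc : 0 < Λ.c) :
    GaussianSchur Λ.arcMeasure Λ.c := by
  intro t ht
  have hpi := Real.pi_pos
  have hmeas : Measurable fun p : Plane × Plane =>
      ENNReal.ofReal (Real.exp (-(1 / (4 * t)) * ‖p.1 - p.2‖ ^ 2)) :=
    ENNReal.measurable_ofReal.comp (Continuous.measurable (by fun_prop))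
  have hsf : SFinite Λ.arcMeasure := by unfold arcMeasure; infer_instance
  rw [arcMeasure] at hsf ⊢
  rw [ae_map_iff (aemeasurable_param hΛ)
    (measurableSet_le hmeas.lintegral_prod_right' measurable_const)]
  rw [ae_restrict_iff' Λ.measurableSet_dom]
  refine ae_of_all _ fun s hs => ?_
  rw [lintegral_map' (by fun_prop) (aemeasurable_param hΛ)]
  have hβ : 0 < Λ.c ^ 2 / (4 * t) := by positivity
  have h1 : ∫⁻ s' in Λ.dom, ENNReal.ofReal
      (Real.exp (-(1 / (4 * t)) * ‖Λ.param s - Λ.param s'‖ ^ 2))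
      ≤ ∫⁻ s' in Λ.dom, ENNReal.ofReal
        (Real.exp (-(Λ.c ^ 2 / (4 * t)) * Λ.arcDist s s' ^ 2)) := by
    refine setLIntegral_mono' Λ.measurableSet_dom fun s' hs' => ?_
    refine ENNReal.ofReal_le_ofReal (Real.exp_le_exp.mpr ?_)
    have h2 := pow_le_pow_left₀ (mul_nonneg hc.le (arcDist_nonneg hs hs'))
      (c_mul_arcDist_le hs hs') 2
    rw [neg_mul, neg_mul, neg_le_neg_iff]
    calc Λ.c ^ 2 / (4 * t) * Λ.arcDist s s' ^ 2 = 1 / (4 * t) * (Λ.c * Λ.arcDist s s') ^ 2 := by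
          ring
      _ ≤ _ := mul_le_mul_of_nonneg_left h2 (by positivity)
  refine (h1.trans (lintegral_arcDist_le hΛ hβ hs)).trans_eq ?_
  rw [show Real.pi / (Λ.c ^ 2 / (4 * t)) = (4 * Real.pi * t) / Λ.c ^ 2 by field_simp,
    Real.sqrt_div (by positivity), Real.sqrt_sq hc.le]

end Curve

/-- This permits truncating a curve of infinite length without changing the constant. -/
theorem GaussianSchur.mono {ν ν' : Measure Plane} {c : ℝ} (h : GaussianSchur ν c) (hle : ν' ≤ ν) :
    GaussianSchur ν' c := fun t ht =>
  Eventually.mono (ae_mono hle (h t ht)) fun _ hx => (lintegral_mono' hle le_rfl).trans hx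

namespace Curve

/-- The duality argument needs a finite measure. It is applied to the pieces with parameter in `[-n,
n]`, with constants independent of `n`, and then `n → ∞`. -/
theorem lintegral_arcMeasure_le {Λ : Curve} (hΛ : Λ.IsAdmissible) (hc : 0 < Λ.c) {κ : ℝ}
    (hκ : 0 < κ) (ψ : 𝓢(Plane, ℂ)) :
    ∫⁻ x, ‖ψ x‖ₑ ^ 2 ∂Λ.arcMeasure ≤
      ENNReal.ofReal (1 / (2 * κ * Λ.c) * (gradNormSq (schwartzToH1 ψ)
          + κ ^ 2 * ‖ψ.toLp 2 (volume : Measure Plane)‖ ^ 2)) := by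
  have hψ : Measurable fun x => ‖ψ x‖ₑ ^ 2 := by
    have := ψ.continuous
    fun_prop
  have hγ := aemeasurable_param hΛ
  rw [arcMeasure, lintegral_map' hψ.aemeasurable hγ]
  have hcover : AECover (volume.restrict Λ.dom) atTop fun n : ℕ => Icc (-(n : ℝ)) n :=
    aecover_Icc (tendsto_neg_atTop_atBot.comp tendsto_natCast_atTop_atTop)
      tendsto_natCast_atTop_atTop
  refine le_of_tendsto' (hcover.lintegral_tendsto_of_countably_generated
    (f := fun s => ‖ψ (Λ.param s)‖ₑ ^ 2) (hψ.comp_aemeasurable hγ)) fun n => ?_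
  set μ := (volume.restrict Λ.dom).restrict (Icc (-(n : ℝ)) n) with hμ
  have hle : μ ≤ volume.restrict Λ.dom := Measure.restrict_le_self
  have hγ' : AEMeasurable Λ.param μ := hγ.mono_measure hle
  have hfin : IsFiniteMeasure μ := ⟨by
    rw [hμ, Measure.restrict_apply_univ]
    exact (Measure.restrict_le_self _).trans_lt measure_Icc_lt_top⟩
  have hmap : μ.map Λ.param ≤ Λ.arcMeasure := by
    refine Measure.le_iff.mpr fun B hB => ?_
    rw [arcMeasure, Measure.map_apply_of_aemeasurable hγ' hB,
      Measure.map_apply_of_aemeasurable hγ hB]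
    exact hle _
  rw [← lintegral_map' hψ.aemeasurable hγ']
  exact ((gaussianSchur_arcMeasure hΛ hc).mono hmap).lintegral_enorm_sq_le hc hκ ψ

end Curve

/-! ### Summation over the edges -/

theorem hasTraceBound_carrier {N : ℕ} (G : MetricGraph N) (ext : Fin N → Curve)
    (hext : ∀ i, (ext i).IsAdmissible) (hsub : ∀ i, G.edge i ⊆ (ext i).carrier)
    (hc : ∀ i, 0 < (ext i).c) :
    HasTraceBound G.carrier fun α => N * ∑ i, α ^ 2 / (4 * (ext i).c ^ 2) := by
  intro α hα ψ
  set g := gradNormSq (schwartzToH1 ψ) with hg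
  have hg0 : 0 ≤ g := gradNormSq_nonneg _
  set n := ‖ψ.toLp 2 (volume : Measure Plane)‖ ^ 2 with hn
  have hn0 : 0 ≤ n := sq_nonneg _
  have hedge : ∀ i, ENNReal.ofReal α * ∫⁻ x, ‖ψ x‖ₑ ^ 2 ∂(lengthMeasure (G.edge i)) ≤
      ENNReal.ofReal (g / N + N * (α ^ 2 / (4 * (ext i).c ^ 2)) * n) := by
    intro i
    have hN : (0 : ℝ) < N := by exact_mod_cast i.pos
    have hci := hc i
    have h1 : lengthMeasure (G.edge i) ≤ (ext i).arcMeasure :=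
      restrict_hausdorffMeasure_le_map (ext i).measurableSet_dom
        ((hext i).isPiecewiseC1.lipschitzOnWith (ext i).ordConnected_dom) (hsub i)
    have h2 := (lintegral_mono' h1 le_rfl).trans
      -- This `κ` gives `α / (2κc) = 1 / N`, and then `κ² / N = N α² / (4c²)`.
      (Curve.lintegral_arcMeasure_le (hext i) hci (κ := N * α / (2 * (ext i).c)) (by positivity) ψ)
    refine (mul_le_mul_right h2 _).trans_eq ?_
    rw [← ENNReal.ofReal_mul hα.le]
    congr 1
    rw [← hg, ← hn]
    field_simp
    ring
  calc ENNReal.ofReal α * ∫⁻ x, ‖ψ x‖ₑ ^ 2 ∂(lengthMeasure G.carrier)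
      ≤ ENNReal.ofReal α * ∑ i, ∫⁻ x, ‖ψ x‖ₑ ^ 2 ∂(lengthMeasure (G.edge i)) := by
        refine mul_le_mul_right ?_ _
        rw [← tsum_fintype (L := .unconditional _), ← lintegral_sum_measure]
        exact lintegral_mono' Measure.restrict_iUnion_le le_rfl
    _ ≤ ∑ i, ENNReal.ofReal (g / N + N * (α ^ 2 / (4 * (ext i).c ^ 2)) * n) := by
        rw [Finset.mul_sum]
        exact Finset.sum_le_sum fun i _ => hedge i
    _ ≤ ENNReal.ofReal (g + N * (∑ i, α ^ 2 / (4 * (ext i).c ^ 2)) * n) := by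
        rw [← ENNReal.ofReal_sum_of_nonneg fun i _ => by positivity]
        refine ENNReal.ofReal_le_ofReal ?_
        rw [Finset.sum_add_distrib, Finset.sum_const, Finset.card_univ, Fintype.card_fin,
          nsmul_eq_mul, ← Finset.sum_mul, ← Finset.mul_sum]
        gcongr
        -- For `N = 0` the gradient terms form an empty sum, so only `0 ≤ g` is needed.
        rcases Nat.eq_zero_or_pos N with rfl | hN
        · simpa using hg0
        · have : (N : ℝ) ≠ 0 := by exact_mod_cast hN.ne'
          rw [mul_div_cancel₀ _ this]

end Leaky

end

theorem mainTheorem4 {N : ℕ} (G : Leaky.MetricGraph N) (α : ℝ) (hα : 0 < α)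
    (hstraight : ∀ i, ¬ Bornology.IsBounded (G.dom i) →
      Leaky.IsAsymptoticallyStraight (G.param i) (G.dom i))
    (ext : Fin N → Leaky.Curve)
    (hext : ∀ i, (ext i).IsAdmissible)
    (hsub : ∀ i, G.edge i ⊆ (ext i).carrier)
    (hc : ∀ i, 0 < (ext i).c) :
    (∃! T : Leaky.H1 →ₗ[ℂ] Leaky.L2On G.carrier, Leaky.IsTraceOperator G.carrier T) ∧
    ∀ T : Leaky.H1 →ₗ[ℂ] Leaky.L2On G.carrier, Leaky.IsTraceOperator G.carrier T →
      (Leaky.deltaForm α T).IsClosed ∧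
      (Leaky.deltaForm α T).IsBoundedBelow ∧
      (∃! H : Leaky.L2 →ₗ.[ℂ] Leaky.L2, IsSelfAdjoint H ∧ (Leaky.deltaForm α T).Corresponds H) ∧
      ∀ H : Leaky.L2 →ₗ.[ℂ] Leaky.L2, IsSelfAdjoint H → (Leaky.deltaForm α T).Corresponds H →
        ((-(N * ∑ i, α ^ 2 / (4 * (ext i).c ^ 2)) : ℝ) : EReal) ≤ Leaky.infSpectrum H := by
  have hbound := Leaky.hasTraceBound_carrier G ext hext hsub hc
  have hM : ∀ a : ℝ, 0 ≤ (N : ℝ) * ∑ i, a ^ 2 / (4 * (ext i).c ^ 2) := fun a => by positivity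
  refine ⟨hbound.existsUnique hM, fun T hT => ?_⟩
  have hlow := hT.le_quad hbound hM hα
  have r := hT.realization hbound hM hα
  exact ⟨r.isClosed, ⟨_, hlow⟩, r.existsUnique_operator hlow Leaky.dense_H1,
    fun H hH hq => r.le_infSpectrum hlow hH hq⟩
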